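/- Let $d\ge 1$ and $x\in(0,\infty)^d$. Let $Y^{(1)},Y^{(2)},\dots$ be i.i.d. random vectors in $\mathbb R^d$ and, independently of them, let $0<A^{(1)}<A^{(2)}<\cdots$ be the arrival times of a unit-rate Poisson process. Put $M_k=\sup_{n\ge1}Y^{(n)}_k/A^{(n)}$ and $V_x^{(n)}=\max_{1\le k\le d}x_kY^{(n)}_k$, and let $P_0$ be the law of the random counting measure $N=\sum_{n\ge1}\delta_{(A^{(n)},V_x^{(n)})}$ on $\mathbb R^2$. Then $$\mathbb P\big(M_1\le x_1^{-1},\dots,M_d\le x_d^{-1}\big)=P_0\big(v\le a\text{ for every point }(a,v)\text{ of }N\big).$$ For points of $\mathbb R^2$ let $c((s,u),(t,v))=|u-v|$ if $s=t$ and $=\infty$ if $s\neq t$. For counting measures $N=\sum_{i}\delta_{p_i}$ and $N'=\sum_{i}\delta_{q_i}$ with finitely or countably many points, let $\widetilde c(N,N')=\inf_\sigma\sum_i c(p_i,q_{\sigma(i)})$, the infimum being over all bijections between the points of $N$ and the points of $N'$ (and $\widetilde c(N,N')=\infty$ if the numbers of points differ). For laws $P,Q$ of random counting measures on $\mathbb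 R^2$ let $W_c(P,Q)=\inf_\gamma \mathbb E_{(N,N')\sim\gamma}[\widetilde c(N,N')]$, the infimum being over all couplings $\gamma$ of $P$ and $Q$. Let $\delta\ge0$ and consider, for $\lambda\in[0,\infty)$, the dual objective $$g(\lambda)=\lambda\delta+\mathbb E\Big[\Big(1-\lambda\min_{n\ge1}\big(A^{(n)}-V_x^{(n)}\big)^+\Big)^+\Big].$$ If $\delta>0$, then $g$ has a minimizer on $[0,\infty)$. If $\lambda^\star\in[0,\infty)$ is a minimizer of $g$, then the worst-case CDF is $$\inf_{P:\,W_c(P,P_0)\le\delta}P\big(v\le a\text{ for every point }(a,v)\text{ of }N\big)=\exp\Big(-\mathbb E_{N\sim P_0}\big[N(\mathcal C_{1/\lambda^\star})\big]\Big),\qquad \mathcal C_{1/\lambda^\star}=\Big\{(a,v)\in\mathbb R^2: v>a-\tfrac1{\lambda^\star}\Big\},$$ with the conventions $1/0=\infty$ (so that $\mathcal C_\infty=\mathbb R^2$) and $\exp(-\infty)=0$. The same value is obtained if the event on the left is replaced by $N(\mathcal C)=0$ with $\mathcal C=\{(a,v):0\le a\le v\}$. -/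

import Mathlib

open MeasureTheory ProbabilityTheory
open scoped ENNReal NNReal

noncomputable section

namespace MEV

/-- `N` is a counting measure on the time-mark plane: a sum of unit point masses over a countable
(finite or infinite) family of points, repetitions allowed. -/
def IsCounting (N : Measure (ℝ × ℝ)) : Prop :=
  ∃ (s : Set ℕ) (p : s → ℝ × ℝ), N = Measure.sum fun i => Measure.dirac (p i)

/-- Counting measures on the time-mark plane, with the σ-algebra generated by the counts
`N ↦ N B`, for `B` Borel. -/
abbrev Config : Type := {N : Measure (ℝ × ℝ) // IsCounting N}

open Classical in
/-- Transport cost between two points (time, mark): the distance of the marks if the times agree,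
and `∞` otherwise. -/
def pointCost (p q : ℝ × ℝ) : ℝ≥0∞ :=
  if p.1 = q.1 then ENNReal.ofReal |p.2 - q.2| else ⊤

/-- Cost between counting measures: the infimum, over all ways of matching their points one to one,
of the total cost of the matched pairs. A matching is a pair of enumerations by a common index set;
there is none, and the cost is `∞`, if the numbers of points differ. -/
def matchingCost (N N' : Config) : ℝ≥0∞ :=
  ⨅ (s : Set ℕ) (p : s → ℝ × ℝ) (q : s → ℝ × ℝ)
    (_ : N.1 = Measure.sum fun i => Measure.dirac (p i))
    (_ : N'.1 = Measure.sum fun i => Measure.dirac (q i)),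
    ∑' i, pointCost (p i) (q i)

/-- Wasserstein distance between two laws of random counting measures. -/
def wasserstein (P Q : Measure Config) : ℝ≥0∞ :=
  ⨅ (γ : Measure (Config × Config)) (_ : γ.map Prod.fst = P) (_ : γ.map Prod.snd = Q),
    ∫⁻ z, matchingCost z.1 z.2 ∂γ

/-- The probability laws of random counting measures at Wasserstein distance at most `δ`
from `P₀`. -/
def wassersteinBall (P₀ : Measure Config) (δ : ℝ≥0) : Set (Measure Config) :=
  {P | IsProbabilityMeasure P ∧ wasserstein P P₀ ≤ δ}

/-- The closed region `{(a, v) : 0 ≤ a ≤ v}`. -/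
def region : Set (ℝ × ℝ) := {z | 0 ≤ z.1 ∧ z.1 ≤ z.2}

/-- The shifted region `{(a, v) : v > a - r}` for `0 ≤ r ≤ ∞`; it is the whole plane
for `r = ∞`. -/
def shiftedRegion (r : ℝ≥0∞) : Set (ℝ × ℝ) :=
  {z | (z.1 : EReal) < (z.2 : EReal) + (r : EReal)}

/-- Probability under `P` that `v ≤ a` for all points `(a, v)` of the counting measure. -/
def cdfProb (P : Measure Config) : ℝ≥0∞ :=
  P {N | N.1 {z : ℝ × ℝ | z.1 < z.2} = 0}

/-- Probability under `P` that the counting measure has no point in `region`. -/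
def voidProb (P : Measure Config) : ℝ≥0∞ :=
  P {N | N.1 region = 0}

variable {Ω : Type*}

/-- Arrival times with interarrival times `ξ`; the first arrival has index `0`. -/
def arrival (ξ : ℕ → Ω → ℝ) (n : ℕ) (ω : Ω) : ℝ :=
  ∑ i ∈ Finset.range (n + 1), ξ i ω

/-- The marks `V_x = max_k x_k Y_k`. -/
def mark {d : ℕ} (x : Fin d → ℝ) (Y : ℕ → Ω → Fin d → ℝ) (n : ℕ) (ω : Ω) : ℝ :=
  ⨆ k, x k * Y n ω k

/-- Component `k` of the componentwise maximum `M = max_n Y n / A n`, as an extended real. -/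
def maxComponent {d : ℕ} (ξ : ℕ → Ω → ℝ) (Y : ℕ → Ω → Fin d → ℝ) (k : Fin d) (ω : Ω) : EReal :=
  ⨆ n, ((Y n ω k / arrival ξ n ω : ℝ) : EReal)

/-- The counting measure with points `(A n, V n)`. -/
def baseline (A V : ℕ → Ω → ℝ) (ω : Ω) : Config :=
  ⟨Measure.sum fun i : (Set.univ : Set ℕ) => Measure.dirac (A i ω, V i ω), Set.univ, _, rfl⟩

/-- The dual objective `λ δ + E[(1 - λ min_n (A n - V n)⁺)⁺]`. -/
def dualObjective [MeasurableSpace Ω] (μ : Measure Ω) (A V : ℕ → Ω → ℝ) (δ lam : ℝ≥0) : ℝ :=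
  lam * δ + ∫ ω, max (1 - lam * ⨅ n, max (A n ω - V n ω) 0) 0 ∂μ

end MEV

end

/-! Let D = min_n (A_n - V_n)⁺ be the `gap`: since times cannot move, this is the least cost of
pushing some baseline point up to the diagonal. Both events are treated at once as "no point in B",
where B lies in {a ≤ v} and contains every point strictly above the diagonal at the baseline arrival
times.

Lower bound: a configuration charging B is at cost at least D from the baseline one, so min(D, r) ≤
r·1{no point in B} + cost. Integrating over a nearly optimal coupling gives P(no point in B) ≥ μ(D ≥
r) as soon as E[D; D < r] ≥ δ. Upper bound: raise one nearly minimizing mark just above its arrival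
time exactly when D < r. This costs about E[D; D < r], affordable when that is at most δ, and leaves
B empty only on {D ≥ r}. Together these are `iInf_ball_eq`.

The dual problem selects r. The objective is convex, with slope δ - E[D; D < 1/λ] at λ, so a
minimizer λ satisfies E[D; D < 1/λ] = δ if λ > 0, and E[D] ≤ δ if λ = 0 (`setLIntegral_gap_le`,
`le_setLIntegral_gap`). Equality needs D to have no atom at 1/λ.

Finally, for finite r > 0, {D ≥ r} says that no point lies in the shifted region, so its probability
is the Poisson void probability (`measure_forall_le_arrival`). That formula comes from conditioning
on the first arrival, which yields a linear differential equation for the void probability as a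
function of the starting time. It also excludes atoms of D on (0, ∞), since the mean count is
Lipschitz in r (`exceedance_le_add`). -/

namespace MEV

/-! ### Iterated exponential averages and the mean measure of the arrivals -/

/-- Averages of `f` over an exponential shift, as integrals against Lebesgue measure. -/
lemma lintegral_shift_expMeasure {f : ℝ → ℝ≥0∞} (hf : Measurable f) (t : ℝ) :
    ∫⁻ s, f (t + s) ∂expMeasure 1 =
      ∫⁻ u in Set.Ioi t, f u * ENNReal.ofReal (Real.exp (t - u)) := by
  have h1 : expMeasure 1 = volume.withDensity (exponentialPDF 1) := rfl
  have hm : Measurable (exponentialPDF 1) := (measurable_exponentialPDFReal 1).ennreal_ofReal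
  rw [h1, lintegral_withDensity_eq_lintegral_mul (g := fun s => f (t + s)) _ hm
    (hf.comp (measurable_const_add t))]
  have h2 := lintegral_add_left_eq_self (μ := (volume : Measure ℝ))
    (fun u => exponentialPDF 1 (u - t) * f u) t
  simp only [add_sub_cancel_left] at h2
  simp only [Pi.mul_apply]
  rw [h2, ← setLIntegral_congr Ioi_ae_eq_Ici.symm, ← lintegral_indicator measurableSet_Ici]
  refine lintegral_congr fun u => ?_
  by_cases hu : t ≤ u
  · rw [exponentialPDF_of_nonneg (by linarith), Set.indicator_of_mem (Set.mem_Ici.2 hu), mul_comm]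
    simp
  · rw [exponentialPDF_of_neg (by linarith [not_le.1 hu]), Set.indicator_of_notMem (by simpa using hu),
      zero_mul]

/-- Mean of `h` at the `n`-th arrival of a unit-rate Poisson process started at time `t`. -/
noncomputable def arrivalMean (h : ℝ → ℝ≥0∞) : ℕ → ℝ → ℝ≥0∞
  | 0, t => ∫⁻ s, h (t + s) ∂expMeasure 1
  | n + 1, t => ∫⁻ s, arrivalMean h n (t + s) ∂expMeasure 1

/-- Mean of the product of `G` over the first `n` arrivals of a unit-rate Poisson process started
at time `t`. -/
noncomputable def arrivalProd (G : ℝ → ℝ≥0∞) : ℕ → ℝ → ℝ≥0∞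
  | 0, _ => 1
  | n + 1, t => ∫⁻ s, G (t + s) * arrivalProd G n (t + s) ∂expMeasure 1

instance : IsProbabilityMeasure (expMeasure 1) := isProbabilityMeasure_expMeasure one_pos

lemma measurable_lintegral_shift {f : ℝ → ℝ≥0∞} (hf : Measurable f) :
    Measurable fun t => ∫⁻ s, f (t + s) ∂expMeasure 1 :=
  Measurable.lintegral_prod_right' (f := fun z : ℝ × ℝ => f (z.1 + z.2))
    (hf.comp (measurable_fst.add measurable_snd))

lemma measurable_arrivalMean {h : ℝ → ℝ≥0∞} (hh : Measurable h) (n : ℕ) :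
    Measurable (arrivalMean h n) := by
  induction n with
  | zero => exact measurable_lintegral_shift hh
  | succ n ih => exact measurable_lintegral_shift ih

lemma measurable_arrivalProd {G : ℝ → ℝ≥0∞} (hG : Measurable G) (n : ℕ) :
    Measurable (arrivalProd G n) := by
  induction n with
  | zero => exact measurable_const
  | succ n ih => exact measurable_lintegral_shift (hG.mul ih)

lemma setLIntegral_Ioo_pow {t u : ℝ} (htu : t ≤ u) (n : ℕ) :
    ∫⁻ w in Set.Ioo t u, ENNReal.ofReal ((u - w) ^ n / n.factorial) =
      ENNReal.ofReal ((u - t) ^ (n + 1) / (n + 1).factorial) := by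
  have hI : IntervalIntegrable (fun w => (u - w) ^ n / (n.factorial : ℝ)) volume t u :=
    (by fun_prop : Continuous fun w => (u - w) ^ n / (n.factorial : ℝ)).intervalIntegrable _ _
  rw [setLIntegral_congr Ioo_ae_eq_Ioc, ← ofReal_integral_eq_lintegral_ofReal]
  · rw [← intervalIntegral.integral_of_le htu, intervalIntegral.integral_div,
      intervalIntegral.integral_comp_sub_left (fun w => w ^ n) u, integral_pow]
    congr 1
    rw [Nat.factorial_succ]
    push_cast
    field_simp
    simp
  · exact (intervalIntegrable_iff_integrableOn_Ioc_of_le htu).1 hI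
  · refine (ae_restrict_iff' measurableSet_Ioc).2 (ae_of_all _ fun w hw => ?_)
    have : 0 ≤ u - w := by linarith [hw.2]
    simp only [Pi.zero_apply]
    positivity

/-- Index `0` is the first arrival, so arrival `n` has the Gamma density of shape `n + 1`. The
induction integrates out the previous arrival. -/
lemma arrivalMean_eq {h : ℝ → ℝ≥0∞} (hh : Measurable h) (n : ℕ) (t : ℝ) :
    arrivalMean h n t = ∫⁻ u in Set.Ioi t,
      h u * ENNReal.ofReal (Real.exp (t - u)) * ENNReal.ofReal ((u - t) ^ n / n.factorial) := by
  induction n generalizing t with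
  | zero => simp [arrivalMean, lintegral_shift_expMeasure hh]
  | succ n ih =>
    rw [arrivalMean, lintegral_shift_expMeasure (measurable_arrivalMean hh n)]
    simp_rw [ih]
    -- The domain t < w < u is encoded by indicators so that Tonelli applies to a function on the
    -- whole plane.
    let F : ℝ → ℝ → ℝ≥0∞ := fun w u => (Set.Ioi t).indicator 1 w * (Set.Ioi w).indicator 1 u *
      (h u * ENNReal.ofReal (Real.exp (t - u)) * ENNReal.ofReal ((u - w) ^ n / n.factorial))
    have hFm : Measurable (Function.uncurry F) := by
      have h1 : Measurable fun z : ℝ × ℝ => (Set.Ioi t).indicator (1 : ℝ → ℝ≥0∞) z.1 :=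
        (measurable_one.indicator measurableSet_Ioi).comp measurable_fst
      have h2 : Measurable fun z : ℝ × ℝ => (Set.Ioi z.1).indicator (1 : ℝ → ℝ≥0∞) z.2 := by
        have : (fun z : ℝ × ℝ => (Set.Ioi z.1).indicator (1 : ℝ → ℝ≥0∞) z.2) =
            {z : ℝ × ℝ | z.1 < z.2}.indicator 1 := by
          ext z; simp [Set.indicator_apply]
        rw [this]
        exact measurable_one.indicator (measurableSet_lt measurable_fst measurable_snd)
      have h3 : Measurable fun z : ℝ × ℝ => h z.2 := hh.comp measurable_snd
      exact (h1.mul h2).mul ((h3.mul (by fun_prop)).mul (by fun_prop))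
    calc _ = ∫⁻ w, ∫⁻ u, F w u := by
          rw [← lintegral_indicator measurableSet_Ioi]
          refine lintegral_congr fun w => ?_
          by_cases hw : w ∈ Set.Ioi t
          · rw [Set.indicator_of_mem hw, ← lintegral_mul_const'' _ (by fun_prop),
              ← lintegral_indicator measurableSet_Ioi]
            refine lintegral_congr fun u => ?_
            by_cases hu : u ∈ Set.Ioi w
            · simp only [F, Set.indicator_of_mem hw, Set.indicator_of_mem hu, Pi.one_apply, one_mul]
              rw [show t - u = (w - u) + (t - w) by ring, Real.exp_add,
                ENNReal.ofReal_mul (Real.exp_nonneg _)]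
              ring
            · simp [F, Set.indicator_of_notMem hu]
          · simp [F, Set.indicator_of_notMem hw]
      _ = ∫⁻ u, ∫⁻ w, F w u := lintegral_lintegral_swap hFm.aemeasurable
      _ = _ := by
          rw [← lintegral_indicator measurableSet_Ioi]
          refine lintegral_congr fun u => ?_
          by_cases hu : u ∈ Set.Ioi t
          · rw [Set.indicator_of_mem hu, ← setLIntegral_Ioo_pow (le_of_lt hu),
              ← lintegral_const_mul'' _ (by fun_prop), ← lintegral_indicator measurableSet_Ioo]
            refine lintegral_congr fun w => ?_
            by_cases hw : t < w <;> by_cases hwu : w < u <;>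
              simp [F, Set.indicator_apply, hw, hwu]
          · rw [Set.indicator_of_notMem hu, lintegral_eq_zero_iff' (by
              exact (hFm.comp (measurable_id.prodMk measurable_const)).aemeasurable)]
            refine ae_of_all _ fun w => ?_
            have : ¬ (t < w ∧ w < u) := fun H => hu (H.1.trans H.2)
            by_cases hw : t < w
            · have hwu : ¬ w < u := fun H => this ⟨hw, H⟩
              simp [F, Set.indicator_apply, hwu]
            · simp [F, Set.indicator_apply, hw]

/-- The mean measure of a unit-rate Poisson process is Lebesgue measure. -/
lemma tsum_arrivalMean {h : ℝ → ℝ≥0∞} (hh : Measurable h) (t : ℝ) :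
    ∑' n, arrivalMean h n t = ∫⁻ u in Set.Ioi t, h u := by
  simp_rw [arrivalMean_eq hh]
  rw [← lintegral_tsum (fun n => by fun_prop)]
  refine setLIntegral_congr_fun measurableSet_Ioi fun u hu => ?_
  have hu' : 0 ≤ u - t := by linarith [Set.mem_Ioi.1 hu]
  rw [ENNReal.tsum_mul_left, ← ENNReal.ofReal_tsum_of_nonneg (fun n => by positivity)
    (Real.summable_pow_div_factorial _)]
  have : ∑' n : ℕ, (u - t) ^ n / (n.factorial : ℝ) = Real.exp (u - t) := by
    rw [Real.exp_eq_exp_ℝ, NormedSpace.exp_eq_tsum_div]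
  rw [this, mul_assoc, ← ENNReal.ofReal_mul (Real.exp_nonneg _), ← Real.exp_add]
  simp

lemma arrivalProd_le_one {G : ℝ → ℝ≥0∞} (hG1 : ∀ t, G t ≤ 1) (n : ℕ) (t : ℝ) :
    arrivalProd G n t ≤ 1 := by
  induction n generalizing t with
  | zero => exact le_rfl
  | succ n ih =>
    calc arrivalProd G (n + 1) t ≤ ∫⁻ _, 1 ∂expMeasure 1 :=
          lintegral_mono fun s => mul_le_one' (hG1 _) (ih _)
      _ = 1 := by simp

lemma arrivalProd_antitone {G : ℝ → ℝ≥0∞} (hG1 : ∀ t, G t ≤ 1) (t : ℝ) :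
    Antitone fun n => arrivalProd G n t := by
  refine antitone_nat_of_succ_le fun n => ?_
  induction n generalizing t with
  | zero => exact arrivalProd_le_one hG1 _ _
  | succ n ih => exact lintegral_mono fun s => mul_le_mul_right (ih _) _

/-- A union bound: either no arrival is retained, or the number of retained ones is at least one. It
later keeps the void probability near 1 for late starting times. -/
lemma one_le_arrivalProd_add {G h : ℝ → ℝ≥0∞} (hG : Measurable G) (hh : Measurable h)
    (hGh : ∀ t, G t + h t = 1) (n : ℕ) (t : ℝ) :
    1 ≤ arrivalProd G n t + ∑ i ∈ Finset.range n, arrivalMean h i t := by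
  induction n generalizing t with
  | zero => simp [arrivalProd]
  | succ n ih =>
    have hG1 : ∀ t, G t ≤ 1 := fun t => (hGh t) ▸ le_self_add
    have hsum : ∑ i ∈ Finset.range (n + 1), arrivalMean h i t =
        ∫⁻ s, (∑ i ∈ Finset.range n, arrivalMean h i (t + s)) + h (t + s) ∂expMeasure 1 := by
      rw [Finset.sum_range_succ', lintegral_add_right (g := fun s => h (t + s)) _
        (hh.comp (measurable_const_add t)),
        lintegral_finsetSum (f := fun i s => arrivalMean h i (t + s)) _ fun i _ =>
          (measurable_arrivalMean hh i).comp (measurable_const_add t)]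
      rfl
    rw [hsum, arrivalProd, ← lintegral_add_left
      (f := fun s => G (t + s) * arrivalProd G n (t + s)) ((hG.mul (measurable_arrivalProd hG n)).comp (measurable_const_add t))]
    calc (1 : ℝ≥0∞) = ∫⁻ _, 1 ∂expMeasure 1 := by simp
      _ ≤ _ := by
        refine lintegral_mono fun s => ?_
        set u := t + s
        set S := ∑ i ∈ Finset.range n, arrivalMean h i u
        calc (1 : ℝ≥0∞) = G u * 1 + h u := by rw [mul_one, hGh]
          _ ≤ G u * (arrivalProd G n u + S) + h u := by gcongr; exact ih u
          _ ≤ G u * arrivalProd G n u + (S + h u) := by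
            rw [mul_add, ← add_assoc]
            gcongr
            exact mul_le_of_le_one_left' (hG1 u)

/-! ### The void probability through a differential equation -/

/-- Mean of the product of `G` over all arrivals of a unit-rate Poisson process started at `t`. -/
noncomputable def arrivalProdLim (G : ℝ → ℝ≥0∞) (t : ℝ) : ℝ≥0∞ := ⨅ n, arrivalProd G n t

section

variable {G h : ℝ → ℝ≥0∞}

lemma measurable_arrivalProdLim (hG : Measurable G) : Measurable (arrivalProdLim G) :=
  Measurable.iInf fun n => measurable_arrivalProd hG n

lemma arrivalProdLim_le_one (t : ℝ) : arrivalProdLim G t ≤ 1 := iInf_le _ 0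

/-- The renewal equation: conditioning on the first arrival reproduces the same process started
there, and monotone convergence passes it to infinitely many arrivals. -/
lemma arrivalProdLim_eq_lintegral (hG : Measurable G) (hG1 : ∀ t, G t ≤ 1) (t : ℝ) :
    arrivalProdLim G t = ∫⁻ u in Set.Ioi t,
      G u * arrivalProdLim G u * ENNReal.ofReal (Real.exp (t - u)) := by
  rw [← lintegral_shift_expMeasure (f := fun u => G u * arrivalProdLim G u)
    (hG.mul (measurable_arrivalProdLim hG))]
  have h1 : ∀ s, G (t + s) * arrivalProdLim G (t + s) =
      ⨅ n, G (t + s) * arrivalProd G n (t + s) := fun s =>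
    ENNReal.mul_iInf fun H => absurd H ((hG1 _).trans_lt ENNReal.one_lt_top).ne
  simp only [h1]
  rw [lintegral_iInf (f := fun n s => G (t + s) * arrivalProd G n (t + s))]
  · refine le_antisymm (le_iInf fun n => iInf_le _ (n + 1)) (le_iInf fun n => ?_)
    exact (iInf_le _ n).trans (arrivalProd_antitone hG1 t n.le_succ)
  · exact fun n => (hG.mul (measurable_arrivalProd hG n)).comp (measurable_const_add t)
  · exact fun m n hmn s => mul_le_mul_right (arrivalProd_antitone hG1 _ hmn) _
  · refine ((lintegral_mono (g := fun _ => 1) fun s => mul_le_one' (hG1 _)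
      (arrivalProd_le_one hG1 _ _)).trans_lt ?_).ne
    simp

/-- The differential equation for the void probability, solved between `0` and `T`. -/
lemma arrivalProdLim_zero_eq (hG : Measurable G) (hG1 : ∀ t, G t ≤ 1)
    (hGr : ∀ t, ContinuousWithinAt (fun t => (G t).toReal) (Set.Ici t) t) {T : ℝ} (hT : 0 ≤ T) :
    (arrivalProdLim G 0).toReal = (arrivalProdLim G T).toReal *
      Real.exp (-∫ t in (0 : ℝ)..T, (1 - (G t).toReal)) := by
  set g : ℝ → ℝ := fun t => (G t).toReal with hg
  set p : ℝ → ℝ := fun t => (arrivalProdLim G t).toReal with hp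
  have hgm : Measurable g := hG.ennreal_toReal
  have hpm : Measurable p := (measurable_arrivalProdLim hG).ennreal_toReal
  have hg0 : ∀ t, 0 ≤ g t := fun t => ENNReal.toReal_nonneg
  have hp0 : ∀ t, 0 ≤ p t := fun t => ENNReal.toReal_nonneg
  have hg1 : ∀ t, g t ≤ 1 := fun t => ENNReal.toReal_le_of_le_ofReal zero_le_one (by simpa using hG1 t)
  have hp1 : ∀ t, p t ≤ 1 := fun t =>
    ENNReal.toReal_le_of_le_ofReal zero_le_one (by simpa using arrivalProdLim_le_one t)
  set k : ℝ → ℝ := fun u => Real.exp (-u) * (g u * p u) with hk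
  have hkm : Measurable k := (by fun_prop : Measurable fun u : ℝ => Real.exp (-u)).mul (hgm.mul hpm)
  have hkb : ∀ u, ‖k u‖ ≤ ‖Real.exp (-u)‖ := fun u => by
    rw [hk, norm_mul]
    refine mul_le_of_le_one_right (norm_nonneg _) ?_
    rw [Real.norm_of_nonneg (mul_nonneg (hg0 u) (hp0 u))]
    exact mul_le_one₀ (hg1 u) (hp0 u) (hp1 u)
  have hkI : ∀ t, IntegrableOn k (Set.Ioi t) := fun t =>
    Integrable.mono (integrableOn_exp_neg_Ioi t) hkm.aestronglyMeasurable (ae_of_all _ hkb)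
  have hkint : ∀ a b, IntervalIntegrable k volume a b := fun a b =>
    ((by fun_prop : Continuous fun u : ℝ => Real.exp (-u)).intervalIntegrable a b).mono_fun
      hkm.aestronglyMeasurable (ae_of_all _ hkb)
  have hgint : ∀ a b, IntervalIntegrable (fun t => 1 - g t) volume a b := fun a b =>
    (intervalIntegrable_const (c := (1 : ℝ))).mono_fun (measurable_const.sub hgm).aestronglyMeasurable
      (ae_of_all _ fun u => by
        change ‖1 - g u‖ ≤ ‖(1 : ℝ)‖
        rw [norm_one, Real.norm_of_nonneg (sub_nonneg.2 (hg1 u))]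
        exact sub_le_self 1 (hg0 u))
  have hq : ∀ t, Real.exp (-t) * p t = ∫ u in Set.Ioi t, k u := fun t => by
    have h1 : p t = ∫ u in Set.Ioi t, g u * p u * Real.exp (t - u) := by
      rw [hp]
      simp only
      rw [arrivalProdLim_eq_lintegral hG hG1 t, ← integral_toReal]
      · refine setIntegral_congr_fun measurableSet_Ioi fun u _ => ?_
        simp only [ENNReal.toReal_mul, ENNReal.toReal_ofReal (Real.exp_nonneg _), hg]
      · exact ((hG.mul (measurable_arrivalProdLim hG)).mul (by fun_prop)).aemeasurable
      · refine ae_of_all _ fun u => ENNReal.mul_lt_top (ENNReal.mul_lt_top ?_ ?_) ENNReal.ofReal_lt_top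
        · exact (hG1 u).trans_lt ENNReal.one_lt_top
        · exact (arrivalProdLim_le_one u).trans_lt ENNReal.one_lt_top
    rw [h1, ← integral_const_mul]
    refine setIntegral_congr_fun measurableSet_Ioi fun u _ => ?_
    simp only [hk, show t - u = t + -u by ring, Real.exp_add, Real.exp_neg t]
    field_simp
  -- By the renewal equation e⁻ᵗ p(t) is the tail integral of `k`. Written as a primitive, it is
  -- continuous without any regularity of `p`, and this continuity is what makes it right
  -- differentiable.
  set q : ℝ → ℝ := fun t => p 0 - ∫ u in (0 : ℝ)..t, k u with hqdef
  have hqp : ∀ t, q t = Real.exp (-t) * p t := fun t => by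
    have h0 := hq 0
    simp only [neg_zero, Real.exp_zero, one_mul] at h0
    rw [hqdef, hq t]
    simp only
    rw [h0, ← intervalIntegral.integral_Ioi_sub_Ioi' (hkI 0) (hkI t)]
    ring
  have hqc : Continuous q := continuous_const.sub (intervalIntegral.continuous_primitive hkint 0)
  set K : ℝ → ℝ := fun t => ∫ u in (0 : ℝ)..t, (1 - g u) with hK
  have hKc : Continuous K := intervalIntegral.continuous_primitive hgint 0
  have hpc : Continuous p := by
    have : p = fun t => Real.exp t * q t := by
      ext t
      rw [hqp, ← mul_assoc, ← Real.exp_add]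
      simp
    rw [this]
    exact Real.continuous_exp.mul hqc
  have hqd : ∀ t, HasDerivWithinAt q (-k t) (Set.Ici t) t := fun t => by
    have hkc : ContinuousWithinAt k (Set.Ioi t) t :=
      ((by fun_prop : Continuous fun u : ℝ => Real.exp (-u)).continuousWithinAt.mul
        (((hGr t).mono Set.Ioi_subset_Ici_self).mul hpc.continuousWithinAt))
    have := intervalIntegral.integral_hasDerivWithinAt_right (hkint 0 t) (s := Set.Ici t)
      (t := Set.Ioi t) hkm.stronglyMeasurable.stronglyMeasurableAtFilter hkc
    simpa using this.const_sub (p 0)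
  have hKd : ∀ t, HasDerivWithinAt K (1 - g t) (Set.Ici t) t := fun t =>
    intervalIntegral.integral_hasDerivWithinAt_right (hgint 0 t) (s := Set.Ici t)
      (t := Set.Ioi t)
      (measurable_const.sub hgm).stronglyMeasurable.stronglyMeasurableAtFilter
      (continuousWithinAt_const.sub ((hGr t).mono Set.Ioi_subset_Ici_self))
  -- Here q' = -g q and (t - K)' = g, so the product, which is p(t) e^{-K(t)}, is constant. Only
  -- right derivatives exist, as `g` is only right continuous.
  have hR := constant_of_has_deriv_right_zero (f := fun t => q t * Real.exp (t - K t)) (a := 0)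
    (b := T) (hqc.mul (Real.continuous_exp.comp (continuous_id.sub hKc))).continuousOn
    (fun t _ => by
      have := (hqd t).mul ((hasDerivWithinAt_id t _).sub (hKd t)).exp
      have h0 : -k t * Real.exp (((id : ℝ → ℝ) - K) t) +
          q t * (Real.exp (((id : ℝ → ℝ) - K) t) * (1 - (1 - g t))) = 0 := by
        rw [hqp]
        simp only [hk]
        ring
      rw [h0] at this
      exact this) T (Set.right_mem_Icc.2 hT)
  have hK0 : K 0 = 0 := by simp [hK]
  simp only [hqp, hK0] at hR
  simp only [neg_zero, Real.exp_zero, one_mul, sub_zero, mul_one] at hR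
  change p 0 = p T * Real.exp (-K T)
  rw [← hR]
  rw [sub_eq_add_neg, Real.exp_add, Real.exp_neg T]
  field_simp

/-- The void probability of a Poisson process thinned with retention function `h`. -/
theorem arrivalProdLim_zero (hG : Measurable G) (hh : Measurable h) (hGh : ∀ t, G t + h t = 1)
    (hGr : ∀ t, ContinuousWithinAt (fun t => (G t).toReal) (Set.Ici t) t) :
    arrivalProdLim G 0 = EReal.exp (-((∫⁻ u in Set.Ioi (0 : ℝ), h u : ℝ≥0∞) : EReal)) := by
  have hG1 : ∀ t, G t ≤ 1 := fun t => (hGh t) ▸ le_self_add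
  have hh1 : ∀ t, h t ≤ 1 := fun t => (hGh t) ▸ le_add_self
  set H := ∫⁻ u in Set.Ioi (0 : ℝ), h u with hH
  set a : ℕ → ℝ≥0∞ := fun n => ∫⁻ u in Set.Ioc (0 : ℝ) n, h u with ha
  set b : ℕ → ℝ≥0∞ := fun n => ∫⁻ u in Set.Ioi (n : ℝ), h u with hb
  have hab : ∀ n, a n + b n = H := fun n => by
    rw [ha, hb, hH]
    simp only
    rw [← lintegral_union measurableSet_Ioi Set.Ioc_disjoint_Ioi_same,
      Set.Ioc_union_Ioi_eq_Ioi (Nat.cast_nonneg n)]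
  have hatop : ∀ n, a n ≠ ⊤ := fun n => by
    refine ((lintegral_mono (g := fun _ => 1) fun u => hh1 u).trans_lt ?_).ne
    simp
  have hatend : Filter.Tendsto a Filter.atTop (nhds H) := by
    have h1 := tendsto_measure_iUnion_atTop (μ := volume.withDensity h)
      (s := fun n : ℕ => Set.Ioc (0 : ℝ) n)
      (fun m n hmn => Set.Ioc_subset_Ioc_right (Nat.cast_le.2 hmn))
    have h2 : ⋃ n : ℕ, Set.Ioc (0 : ℝ) n = Set.Ioi 0 := by
      ext u
      simp only [Set.mem_iUnion, Set.mem_Ioc, Set.mem_Ioi]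
      exact ⟨fun ⟨_, h, _⟩ => h, fun h => (exists_nat_ge u).imp fun n hn => ⟨h, hn⟩⟩
    rw [h2, withDensity_apply _ measurableSet_Ioi] at h1
    refine h1.congr fun n => ?_
    simp [ha, withDensity_apply _ measurableSet_Ioc]
  have hL : ∀ n : ℕ, arrivalProdLim G 0 = arrivalProdLim G n * EReal.exp (-(a n : EReal)) :=
    fun n => by
    have h1 := arrivalProdLim_zero_eq hG hG1 hGr (Nat.cast_nonneg (α := ℝ) n)
    have h2 : ∫ t in (0 : ℝ)..n, (1 - (G t).toReal) = (a n).toReal := by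
      rw [intervalIntegral.integral_of_le (Nat.cast_nonneg n), ha]
      simp only
      rw [← integral_toReal hh.aemeasurable (ae_of_all _ fun u => (hh1 u).trans_lt ENNReal.one_lt_top)]
      refine integral_congr_ae (ae_of_all _ fun u => ?_)
      have := congrArg ENNReal.toReal (hGh u)
      rw [ENNReal.toReal_add ((hG1 u).trans_lt ENNReal.one_lt_top).ne
        ((hh1 u).trans_lt ENNReal.one_lt_top).ne, ENNReal.toReal_one] at this
      simp only
      linarith
    have hfin : ∀ t, arrivalProdLim G t ≠ ⊤ := fun t =>
      ((arrivalProdLim_le_one t).trans_lt ENNReal.one_lt_top).ne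
    have h3 : (-(a n : EReal)) = ((-(a n).toReal : ℝ) : EReal) := by
      rw [EReal.coe_neg, EReal.coe_ennreal_toReal (hatop n)]
    rw [h3, EReal.exp_coe, ← ENNReal.ofReal_toReal (hfin 0), h1, h2,
      ENNReal.ofReal_mul ENNReal.toReal_nonneg, ENNReal.ofReal_toReal (hfin _)]
  have hE : Filter.Tendsto (fun n => EReal.exp (-(a n : EReal))) Filter.atTop
      (nhds (EReal.exp (-(H : EReal)))) :=
    (ENNReal.continuous_exp.tendsto _).comp ((continuous_neg.tendsto _).comp
      ((continuous_coe_ennreal_ereal.tendsto _).comp hatend))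
  refine le_antisymm (ge_of_tendsto' hE fun n => ?_) ?_
  · rw [hL n]
    exact mul_le_of_le_one_left' (arrivalProdLim_le_one _)
  -- For infinite mean the bound is trivial. Otherwise the tails `b n` vanish and the union bound
  -- started at time `n` shows that the factor at `n` is at least 1 - b n.
  · rcases eq_or_ne H ⊤ with hHt | hHt
    · simp [hHt]
    have hbtend : Filter.Tendsto (fun n => arrivalProdLim G 0 + b n) Filter.atTop
        (nhds (arrivalProdLim G 0 + (H - H))) := by
      refine tendsto_const_nhds.add ?_
      have : b = fun n => H - a n := by
        ext n
        rw [← hab n, ENNReal.add_sub_cancel_left (hatop n)]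
      rw [this]
      exact ENNReal.Tendsto.sub tendsto_const_nhds hatend (Or.inl hHt)
    rw [tsub_self, add_zero] at hbtend
    refine le_of_tendsto_of_tendsto' hE hbtend fun n => ?_
    have h1 : 1 ≤ arrivalProdLim G n + b n := by
      rw [arrivalProdLim, ENNReal.iInf_add]
      refine le_iInf fun m => (one_le_arrivalProd_add hG hh hGh m n).trans ?_
      simp only [hb]
      rw [← tsum_arrivalMean hh]
      gcongr
      exact ENNReal.sum_le_tsum _
    have h2 : EReal.exp (-(a n : EReal)) ≤ 1 := by
      rw [EReal.exp_le_one_iff, EReal.neg_le_zero]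
      exact EReal.coe_ennreal_nonneg _
    calc EReal.exp (-(a n : EReal)) ≤ (arrivalProdLim G n + b n) * EReal.exp (-(a n : EReal)) :=
          le_mul_of_one_le_left' h1
      _ = arrivalProdLim G 0 + b n * EReal.exp (-(a n : EReal)) := by rw [add_mul, ← hL n]
      _ ≤ _ := by
        gcongr
        exact mul_le_of_le_one_right' h2

end

/-! ### Marked Poisson processes on the probability space -/

section

variable {Ω : Type*}

lemma arrival_succ (ξ : ℕ → Ω → ℝ) (n : ℕ) (ω : Ω) :
    arrival ξ (n + 1) ω = ξ 0 ω + arrival (fun k => ξ (k + 1)) n ω := by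
  simp only [arrival]
  rw [Finset.sum_range_succ' _ (n + 1), add_comm]

lemma arrival_zero (ξ : ℕ → Ω → ℝ) (ω : Ω) : arrival ξ 0 ω = ξ 0 ω := by simp [arrival]

variable [MeasurableSpace Ω] {μ : Measure Ω}

/-- In an independent sequence, the first term is independent of the shifted sequence. -/
lemma indepFun_zero_shift {ξ : ℕ → Ω → ℝ} (hξm : ∀ n, Measurable (ξ n)) (hξ : iIndepFun ξ μ) :
    IndepFun (ξ 0) (fun ω n => ξ (n + 1) ω) μ := by
  have h := indep_iSup_of_disjoint (S := {0}) (T := {0}ᶜ) (fun n => (hξm n).comap_le)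
    ((iIndepFun_iff_iIndep _ _ _).1 hξ) disjoint_compl_right
  rw [IndepFun_iff_Indep]
  refine indep_of_indep_of_le h ?_ ?_
  · exact le_iSup₂_of_le 0 (Set.mem_singleton 0) le_rfl
  · refine Measurable.comap_le ?_
    refine @measurable_pi_lambda _ _ _ (_) _ _ fun n => ?_
    exact Measurable.mono (comap_measurable (ξ (n + 1)))
      (le_iSup₂_of_le (f := fun i (_ : i ∈ ({0}ᶜ : Set ℕ)) =>
        MeasurableSpace.comap (ξ i) inferInstance) (n + 1) (by simp) le_rfl) le_rfl

lemma measurable_arrival {ξ : ℕ → Ω → ℝ} (hξm : ∀ n, Measurable (ξ n)) (n : ℕ) :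
    Measurable (arrival ξ n) := by
  unfold arrival
  fun_prop

/-- Conditioning on the first interarrival time. -/
lemma lintegral_first_arrival [IsProbabilityMeasure μ] {ξ : ℕ → Ω → ℝ}
    (hξm : ∀ n, Measurable (ξ n)) (hξ : iIndepFun ξ μ) (hξlaw : ∀ n, μ.map (ξ n) = expMeasure 1)
    {Φ : ℝ → (ℕ → ℝ) → ℝ≥0∞} (hΦ : Measurable (Function.uncurry Φ)) :
    ∫⁻ ω, Φ (ξ 0 ω) (fun n => ξ (n + 1) ω) ∂μ =
      ∫⁻ s, ∫⁻ ω, Φ s (fun n => ξ (n + 1) ω) ∂μ ∂expMeasure 1 := by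
  have hm : Measurable fun ω => fun n => ξ (n + 1) ω := measurable_pi_lambda _ fun n => hξm _
  have h1 := (indepFun_iff_map_prod_eq_prod_map_map (hξm 0).aemeasurable hm.aemeasurable).1
    (indepFun_zero_shift hξm hξ)
  have h2 : ∫⁻ ω, Φ (ξ 0 ω) (fun n => ξ (n + 1) ω) ∂μ =
      ∫⁻ z, Function.uncurry Φ z ∂(μ.map fun ω => (ξ 0 ω, fun n => ξ (n + 1) ω)) := by
    rw [lintegral_map hΦ ((hξm 0).prodMk hm)]
    rfl
  rw [h2, h1, lintegral_prod _ hΦ.aemeasurable, hξlaw 0]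
  refine lintegral_congr fun s => ?_
  rw [lintegral_map (f := fun z => Function.uncurry Φ (s, z)) (hΦ.comp measurable_prodMk_left) hm]
  rfl

lemma lintegral_prod_arrival [IsProbabilityMeasure μ] {G : ℝ → ℝ≥0∞} (hG : Measurable G) (n : ℕ)
    {ξ : ℕ → Ω → ℝ} (hξm : ∀ n, Measurable (ξ n)) (hξ : iIndepFun ξ μ)
    (hξlaw : ∀ n, μ.map (ξ n) = expMeasure 1) (t : ℝ) :
    ∫⁻ ω, ∏ i ∈ Finset.range n, G (t + arrival ξ i ω) ∂μ = arrivalProd G n t := by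
  induction n generalizing ξ t with
  | zero => simp [arrivalProd]
  | succ n ih =>
    have hΦ : Measurable (Function.uncurry fun (s : ℝ) (z : ℕ → ℝ) => G (t + s) *
        ∏ i ∈ Finset.range n, G (t + s + ∑ j ∈ Finset.range (i + 1), z j)) := by
      refine (hG.comp (by fun_prop)).mul (Finset.measurable_fun_prod _ fun i _ => hG.comp ?_)
      fun_prop
    have h := lintegral_first_arrival hξm hξ hξlaw hΦ
    rw [arrivalProd]
    calc _ = _ := by
          refine lintegral_congr fun ω => ?_
          rw [Finset.prod_range_succ', mul_comm]
          simp only [arrival_succ, arrival_zero, ← add_assoc]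
          rfl
      _ = _ := h
      _ = _ := by
          refine lintegral_congr fun s => ?_
          have hm : Measurable fun ω => ∏ i ∈ Finset.range n,
              G (t + s + ∑ j ∈ Finset.range (i + 1), ξ (j + 1) ω) :=
            Finset.measurable_fun_prod _ fun i _ => hG.comp (by fun_prop)
          rw [lintegral_const_mul _ hm]
          congr 1
          exact ih (fun n => hξm (n + 1)) (hξ.precomp (add_left_injective 1))
            (fun n => hξlaw (n + 1)) (t + s)

lemma lintegral_arrival [IsProbabilityMeasure μ] {h : ℝ → ℝ≥0∞} (hh : Measurable h) (n : ℕ)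
    {ξ : ℕ → Ω → ℝ} (hξm : ∀ n, Measurable (ξ n)) (hξ : iIndepFun ξ μ)
    (hξlaw : ∀ n, μ.map (ξ n) = expMeasure 1) (t : ℝ) :
    ∫⁻ ω, h (t + arrival ξ n ω) ∂μ = arrivalMean h n t := by
  induction n generalizing ξ t with
  | zero =>
    simp only [arrival_zero, arrivalMean]
    rw [← hξlaw 0, lintegral_map (f := fun s => h (t + s)) (hh.comp (measurable_const_add t)) (hξm 0)]
  | succ n ih =>
    have hΦ : Measurable (Function.uncurry fun (s : ℝ) (z : ℕ → ℝ) =>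
        h (t + s + ∑ j ∈ Finset.range (n + 1), z j)) := hh.comp (by fun_prop)
    rw [arrivalMean]
    calc _ = _ := by
          refine lintegral_congr fun ω => ?_
          rw [arrival_succ, ← add_assoc]
          rfl
      _ = _ := lintegral_first_arrival hξm hξ hξlaw hΦ
      _ = _ := lintegral_congr fun s => ih (fun n => hξm (n + 1))
          (hξ.precomp (add_left_injective 1)) (fun n => hξlaw (n + 1)) (t + s)

/-- The mean number of points `(a, v)` with `v > a - r` of a marked Poisson process, as an integral
over time. -/
noncomputable def exceedance (μ : Measure Ω) (V : Ω → ℝ) (r : ℝ) : ℝ≥0∞ :=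
  ∫⁻ a in Set.Ioi (0 : ℝ), μ {ω | a < V ω + r}

lemma antitone_exceed (V : Ω → ℝ) (r : ℝ) : Antitone fun a => μ {ω | a < V ω + r} :=
  fun _ _ hab => measure_mono fun _ hω => hab.trans_lt hω

/-- Translating time by s - r turns the level `s` into the level `r` and adds to the domain an
interval of length s - r, on which the integrand is at most 1. -/
lemma exceedance_le_add [IsProbabilityMeasure μ] (V : Ω → ℝ) {r s : ℝ} (hrs : r ≤ s) :
    exceedance μ V s ≤ exceedance μ V r + ENNReal.ofReal (s - r) := by
  set f : ℝ → ℝ≥0∞ := fun a => μ {ω | a < V ω + r}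
  have h1 : exceedance μ V s = ∫⁻ a in Set.Ioi (-(s - r)), f a := by
    rw [exceedance, ← lintegral_indicator measurableSet_Ioi, ← lintegral_indicator measurableSet_Ioi]
    refine (lintegral_add_right_eq_self _ (s - r)).symm.trans (lintegral_congr fun a => ?_)
    have h2 : ∀ ω, a + (s - r) < V ω + s ↔ a < V ω + r := fun ω => by
      constructor <;> intro h <;> linarith
    simp only [Set.indicator_apply, Set.mem_Ioi, f, h2, neg_lt_iff_pos_add]
  rw [h1, exceedance, ← Set.Ioc_union_Ioi_eq_Ioi (show -(s - r) ≤ 0 by linarith), add_comm]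
  refine (lintegral_union_le _ _ _).trans ?_
  gcongr
  calc ∫⁻ a in Set.Ioc (-(s - r)) 0, f a ≤ ∫⁻ _ in Set.Ioc (-(s - r)) 0, 1 :=
        lintegral_mono fun _ => prob_le_one
    _ = ENNReal.ofReal (s - r) := by simp

section marked

variable [IsProbabilityMeasure μ] {ξ V : ℕ → Ω → ℝ}

/-- Conditioning on the arrival times. -/
lemma measure_forall_lt_le_arrival (hξm : ∀ n, Measurable (ξ n)) (hVm : ∀ n, Measurable (V n))
    (hV : iIndepFun V μ) (hVlaw : ∀ n, IdentDistrib (V n) (V 0) μ μ)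
    (hξV : IndepFun (fun ω n => ξ n ω) (fun ω n => V n ω) μ) (r : ℝ) (n : ℕ) :
    μ {ω | ∀ i < n, V i ω + r ≤ arrival ξ i ω} =
      ∫⁻ ω, ∏ i ∈ Finset.range n, μ {ω' | V 0 ω' + r ≤ arrival ξ i ω} ∂μ := by
  have hξ' : Measurable fun ω n => ξ n ω := measurable_pi_lambda _ hξm
  have hV' : Measurable fun ω n => V n ω := measurable_pi_lambda _ hVm
  have hS : MeasurableSet {z : (ℕ → ℝ) × (ℕ → ℝ) |
      ∀ i < n, z.2 i + r ≤ ∑ j ∈ Finset.range (i + 1), z.1 j} := by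
    simp only [Set.ofPred_forall]
    exact MeasurableSet.iInter fun i => MeasurableSet.iInter fun _ =>
      measurableSet_le (by fun_prop) (by fun_prop)
  have h1 := (indepFun_iff_map_prod_eq_prod_map_map hξ'.aemeasurable hV'.aemeasurable).1 hξV
  have h2 : μ {ω | ∀ i < n, V i ω + r ≤ arrival ξ i ω} =
      μ.map (fun ω => (fun n => ξ n ω, fun n => V n ω)) {z : (ℕ → ℝ) × (ℕ → ℝ) |
        ∀ i < n, z.2 i + r ≤ ∑ j ∈ Finset.range (i + 1), z.1 j} := by
    rw [Measure.map_apply (hξ'.prodMk hV') hS]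
    rfl
  rw [h2, h1, Measure.prod_apply hS, lintegral_map (measurable_measure_prodMk_left hS) hξ']
  refine lintegral_congr fun ω => ?_
  rw [Measure.map_apply hV' (measurable_prodMk_left hS)]
  have h3 := hV.measure_inter_preimage_eq_mul (Finset.range n)
    (sets := fun i => {v | v + r ≤ arrival ξ i ω})
    (fun i _ => measurableSet_le (by fun_prop) measurable_const)
  calc _ = μ (⋂ i ∈ Finset.range n, V i ⁻¹' {v | v + r ≤ arrival ξ i ω}) := by
        congr 1
        ext ω'
        simp [arrival]
    _ = _ := h3
    _ = _ := Finset.prod_congr rfl fun i _ => (hVlaw i).measure_mem_eq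
        (measurableSet_le (by fun_prop) measurable_const)

/-- The expected number of exceedances of a marked Poisson process. -/
lemma tsum_measure_exceed (hξm : ∀ n, Measurable (ξ n)) (hVm : ∀ n, Measurable (V n))
    (hξ : iIndepFun ξ μ) (hξlaw : ∀ n, μ.map (ξ n) = expMeasure 1)
    (hVlaw : ∀ n, IdentDistrib (V n) (V 0) μ μ)
    (hξV : IndepFun (fun ω n => ξ n ω) (fun ω n => V n ω) μ) (r : ℝ) :
    ∑' n, μ {ω | arrival ξ n ω < V n ω + r} = exceedance μ (V 0) r := by
  rw [exceedance, ← tsum_arrivalMean (antitone_exceed (V 0) r).measurable]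
  refine tsum_congr fun n => ?_
  rw [← lintegral_arrival (antitone_exceed (V 0) r).measurable n hξm hξ hξlaw]
  have hA := measurable_arrival hξm n
  have hi : IndepFun (arrival ξ n) (V n) μ :=
    hξV.comp (φ := fun z : ℕ → ℝ => ∑ j ∈ Finset.range (n + 1), z j) (ψ := fun z : ℕ → ℝ => z n)
      (by fun_prop) (by fun_prop)
  have hS : MeasurableSet {z : ℝ × ℝ | z.1 < z.2 + r} :=
    measurableSet_lt (by fun_prop) (by fun_prop)
  have h1 := (indepFun_iff_map_prod_eq_prod_map_map hA.aemeasurable (hVm n).aemeasurable).1 hi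
  have h2 : μ {ω | arrival ξ n ω < V n ω + r} =
      μ.map (fun ω => (arrival ξ n ω, V n ω)) {z : ℝ × ℝ | z.1 < z.2 + r} := by
    rw [Measure.map_apply (hA.prodMk (hVm n)) hS]
    rfl
  rw [h2, h1, Measure.prod_apply hS, lintegral_map (measurable_measure_prodMk_left hS) hA]
  refine lintegral_congr fun ω => ?_
  rw [(hVlaw n).map_eq, Measure.map_apply (hVm 0) (measurable_prodMk_left hS)]
  simp [Set.preimage]

/-- The void probability of a marked Poisson process. -/
theorem measure_forall_le_arrival (hξm : ∀ n, Measurable (ξ n)) (hVm : ∀ n, Measurable (V n))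
    (hξ : iIndepFun ξ μ) (hξlaw : ∀ n, μ.map (ξ n) = expMeasure 1)
    (hV : iIndepFun V μ) (hVlaw : ∀ n, IdentDistrib (V n) (V 0) μ μ)
    (hξV : IndepFun (fun ω n => ξ n ω) (fun ω n => V n ω) μ) (r : ℝ) :
    μ {ω | ∀ n, V n ω + r ≤ arrival ξ n ω} = EReal.exp (-(exceedance μ (V 0) r : EReal)) := by
  set G : ℝ → ℝ≥0∞ := fun a => μ {ω | V 0 ω + r ≤ a} with hGdef
  have hVr : Measurable fun ω => V 0 ω + r := (hVm 0).add_const r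
  have hGmono : Monotone G := fun a b hab => measure_mono fun ω (hω : _ ≤ a) => hω.trans hab
  have hGh : ∀ t, G t + μ {ω | t < V 0 ω + r} = 1 := fun t => by
    have := measure_add_measure_compl (μ := μ) (measurableSet_le hVr (measurable_const (a := t)))
    rw [measure_univ] at this
    rw [← this]
    congr 2
    ext ω
    simp
  -- `G` is the distribution function of `V 0 + r`; this supplies the right continuity.
  have hGr : ∀ t, ContinuousWithinAt (fun t => (G t).toReal) (Set.Ici t) t := fun t => by
    have : IsProbabilityMeasure (μ.map fun ω => V 0 ω + r) :=
      Measure.isProbabilityMeasure_map hVr.aemeasurable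
    have h1 : (fun t => (G t).toReal) = cdf (μ.map fun ω => V 0 ω + r) := by
      ext a
      rw [cdf_eq_real, measureReal_def, Measure.map_apply hVr measurableSet_Iic]
      rfl
    rw [h1]
    exact (cdf _).right_continuous t
  have key := arrivalProdLim_zero hGmono.measurable (antitone_exceed (μ := μ) (V 0) r).measurable
    hGh hGr
  rw [exceedance, ← key, arrivalProdLim]
  have hset : {ω | ∀ n, V n ω + r ≤ arrival ξ n ω} =
      ⋂ n, {ω | ∀ i < n, V i ω + r ≤ arrival ξ i ω} := by
    ext ω
    simp only [Set.mem_ofPred_eq, Set.mem_iInter]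
    exact ⟨fun h n i _ => h i, fun h n => h (n + 1) n n.lt_succ_self⟩
  rw [hset, Antitone.measure_iInter]
  · refine iInf_congr fun n => ?_
    rw [measure_forall_lt_le_arrival hξm hVm hV hVlaw hξV,
      ← lintegral_prod_arrival hGmono.measurable n hξm hξ hξlaw]
    simp [hGdef]
  · exact fun m n hmn ω hω i hi => hω i (hi.trans_le hmn)
  · intro n
    refine MeasurableSet.nullMeasurableSet ?_
    simp only [Set.ofPred_forall]
    exact MeasurableSet.iInter fun i => MeasurableSet.iInter fun _ =>
      measurableSet_le ((hVm i).add_const r) (measurable_arrival hξm i)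
  · exact ⟨0, measure_ne_top _ _⟩

end marked

end

/-! ### The gap, matching costs and raised marks -/

section

variable {Ω : Type*}

/-- The smallest distance by which a mark has to be raised to reach its arrival time. -/
noncomputable def gap (A V : ℕ → Ω → ℝ) (ω : Ω) : ℝ≥0∞ := ⨅ n, ENNReal.ofReal (A n ω - V n ω)

lemma toReal_gap (A V : ℕ → Ω → ℝ) (ω : Ω) :
    (gap A V ω).toReal = ⨅ n, max (A n ω - V n ω) 0 := by
  rw [gap, ENNReal.toReal_iInf fun _ => ENNReal.ofReal_ne_top]
  simp only [ENNReal.toReal_ofReal']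

lemma gap_lt_top (A V : ℕ → Ω → ℝ) (ω : Ω) : gap A V ω < ⊤ :=
  (iInf_le _ 0).trans_lt ENNReal.ofReal_lt_top

/-- Positivity of `r` matters: at `r = 0` the truncated differences make the left side always true.
-/
lemma coe_le_gap_iff {A V : ℕ → Ω → ℝ} {ω : Ω} {r : ℝ≥0} (hr : 0 < r) :
    (r : ℝ≥0∞) ≤ gap A V ω ↔ ∀ n, V n ω + r ≤ A n ω := by
  rw [gap, le_iInf_iff]
  refine forall_congr' fun n => ?_
  rw [← ENNReal.ofReal_coe_nnreal, ENNReal.ofReal_le_ofReal_iff', or_iff_left (by simpa using hr)]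
  constructor <;> intro h <;> linarith

section configurations

/-- A sum of point masses does not charge a set exactly if it contains none of the points. -/
lemma sum_dirac_eq_zero_iff {s : Set ℕ} (p : s → ℝ × ℝ) {B : Set (ℝ × ℝ)} (hB : MeasurableSet B) :
    (Measure.sum fun i => Measure.dirac (p i)) B = 0 ↔ ∀ i, p i ∉ B := by
  rw [Measure.sum_apply _ hB, ENNReal.tsum_eq_zero]
  simp [Measure.dirac_apply' _ hB]

lemma baseline_apply (A V : ℕ → Ω → ℝ) (ω : Ω) {B : Set (ℝ × ℝ)} (hB : MeasurableSet B) :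
    (baseline A V ω).1 B = ∑' n, B.indicator 1 (A n ω, V n ω) := by
  rw [baseline, Measure.sum_apply _ hB]
  simp only [Measure.dirac_apply' _ hB]
  exact tsum_univ (fun n => B.indicator (1 : ℝ × ℝ → ℝ≥0∞) (A n ω, V n ω))

lemma baseline_eq_zero_iff (A V : ℕ → Ω → ℝ) (ω : Ω) {B : Set (ℝ × ℝ)} (hB : MeasurableSet B) :
    (baseline A V ω).1 B = 0 ↔ ∀ n, (A n ω, V n ω) ∉ B := by
  rw [baseline, sum_dirac_eq_zero_iff _ hB]
  simp

lemma measurable_baseline [MeasurableSpace Ω] {A V : ℕ → Ω → ℝ} (hA : ∀ n, Measurable (A n))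
    (hV : ∀ n, Measurable (V n)) : Measurable (baseline A V) := by
  refine Measurable.subtype_mk (Measure.measurable_of_measurable_coe _ fun B hB => ?_)
  have : (fun ω => (baseline A V ω).1 B) = fun ω => ∑' n, B.indicator 1 (A n ω, V n ω) :=
    funext fun ω => baseline_apply A V ω hB
  refine (this ▸ ?_ : Measurable fun ω => (baseline A V ω).1 B)
  exact Measurable.tsum fun n => (measurable_one.indicator hB).comp ((hA n).prodMk (hV n))

lemma measurable_config_apply {B : Set (ℝ × ℝ)} (hB : MeasurableSet B) :
    Measurable fun N : Config => N.1 B :=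
  (Measure.measurable_coe hB).comp measurable_subtype_coe

lemma measurableSet_config_void {B : Set (ℝ × ℝ)} (hB : MeasurableSet B) :
    MeasurableSet {N : Config | N.1 B = 0} :=
  measurable_config_apply hB (measurableSet_singleton 0)

lemma mem_shiftedRegion_coe {r : ℝ≥0} {z : ℝ × ℝ} :
    z ∈ shiftedRegion (r : ℝ≥0∞) ↔ z.1 < z.2 + r := by
  change (z.1 : EReal) < (z.2 : EReal) + ((r : ℝ≥0∞) : EReal) ↔ _
  rw [show ((r : ℝ≥0∞) : EReal) = ((r : ℝ) : EReal) from rfl, ← EReal.coe_add, EReal.coe_lt_coe_iff]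

lemma shiftedRegion_top : shiftedRegion ⊤ = Set.univ := by
  refine Set.eq_univ_of_forall fun z => ?_
  change (z.1 : EReal) < (z.2 : EReal) + ((⊤ : ℝ≥0∞) : EReal)
  simp

lemma measurableSet_shiftedRegion_coe (r : ℝ≥0) : MeasurableSet (shiftedRegion (r : ℝ≥0∞)) := by
  have : shiftedRegion (r : ℝ≥0∞) = {z : ℝ × ℝ | z.1 < z.2 + r} :=
    Set.ext fun _ => mem_shiftedRegion_coe
  rw [this]
  exact measurableSet_lt (by fun_prop) (by fun_prop)

open Classical in
/-- The gap of a counting measure. -/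
noncomputable def configGap (N : Config) : ℝ≥0∞ :=
  ⨆ q : ℚ, if N.1 (shiftedRegion (Real.toNNReal q : ℝ≥0∞)) = 0 then (Real.toNNReal q : ℝ≥0∞) else 0

lemma measurable_configGap : Measurable configGap :=
  Measurable.iSup fun _ => Measurable.ite
    (measurableSet_config_void (measurableSet_shiftedRegion_coe _)) measurable_const
    measurable_const

/-- The gap is a measurable function of the counting measure alone, so it can be integrated against
the second marginal of any coupling. -/
lemma configGap_baseline (A V : ℕ → Ω → ℝ) (ω : Ω) : configGap (baseline A V ω) = gap A V ω := by
  have key : ∀ r : ℝ≥0, 0 < r → ((baseline A V ω).1 (shiftedRegion (r : ℝ≥0∞)) = 0 ↔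
      (r : ℝ≥0∞) ≤ gap A V ω) := fun r hr => by
    rw [baseline_eq_zero_iff _ _ _ (measurableSet_shiftedRegion_coe r), coe_le_gap_iff hr]
    simp only [mem_shiftedRegion_coe, not_lt]
  refine le_antisymm (iSup_le fun q => ?_) (le_of_forall_lt fun c hc => ?_)
  · split_ifs with h
    · rcases eq_or_ne (Real.toNNReal q) 0 with h0 | h0
      · simp [h0]
      · exact (key _ (pos_iff_ne_zero.2 h0)).1 h
    · exact zero_le
  · obtain ⟨q, -, hcq, hq⟩ := ENNReal.lt_iff_exists_rat_btwn.1 hc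
    refine hcq.trans_le (le_iSup_of_le q ?_)
    rw [if_pos ((key _ (by exact_mod_cast zero_le.trans_lt hcq)).2 hq.le)]

/-- Matching a counting measure with a point above the diagonal costs at least the gap. -/
lemma configGap_le_matchingCost {N N' : Config} (h : N.1 {z : ℝ × ℝ | z.1 ≤ z.2} ≠ 0) :
    configGap N' ≤ matchingCost N N' := by
  refine le_iInf₂ fun s p => le_iInf₂ fun q hp => le_iInf fun hq => ?_
  rw [hp, Ne, sum_dirac_eq_zero_iff _ (measurableSet_le measurable_fst measurable_snd)] at h
  push Not at h
  obtain ⟨i, hi⟩ := h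
  refine (iSup_le fun t => ?_ : configGap N' ≤ pointCost (p i) (q i)).trans (ENNReal.le_tsum i)
  split_ifs with ht
  · rw [hq, sum_dirac_eq_zero_iff _ (measurableSet_shiftedRegion_coe _)] at ht
    have h1 := ht i
    rw [mem_shiftedRegion_coe, not_lt] at h1
    rw [pointCost]
    split_ifs with hpq
    · rw [ENNReal.ofNNReal_toNNReal]
      refine ENNReal.ofReal_le_ofReal ?_
      have h2 : (p i).1 ≤ (p i).2 := hi
      have h3 := Real.le_coe_toNNReal (t : ℝ)
      exact le_trans (by linarith) (le_abs_self _)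
    · exact le_top
  · exact zero_le

lemma matchingCost_baseline_le (A V V' : ℕ → Ω → ℝ) (ω : Ω) :
    matchingCost (baseline A V' ω) (baseline A V ω) ≤
      ∑' n, ENNReal.ofReal |V' n ω - V n ω| := by
  have h : matchingCost (baseline A V' ω) (baseline A V ω) ≤
      ∑' i : (Set.univ : Set ℕ), pointCost (A i ω, V' i ω) (A i ω, V i ω) :=
    (iInf_le _ Set.univ).trans ((iInf₂_le _ _).trans ((iInf_le _ rfl).trans (iInf_le _ rfl)))
  simp only [pointCost, if_true] at h
  exact h.trans (tsum_univ (fun n => ENNReal.ofReal |V' n ω - V n ω|)).le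

variable {A V : ℕ → Ω → ℝ}

open Classical in
/-- The marks after raising the first mark that nearly realizes the gap slightly above its arrival
time, provided that the gap is smaller than `r`. -/
noncomputable def raisedMark (A V : ℕ → Ω → ℝ) (r : ℝ≥0∞) (ε : ℝ≥0) (n : ℕ) (ω : Ω) : ℝ :=
  if ENNReal.ofReal (A n ω - V n ω) < min r (gap A V ω + ε) ∧
      ∀ j < n, ¬ ENNReal.ofReal (A j ω - V j ω) < min r (gap A V ω + ε)
    then max (V n ω) (A n ω + ε) else V n ω

/-- The infimum defining the gap need not be attained, which costs one `ε`; the other lifts the mark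
strictly above the diagonal. Taking the first suitable index leaves a single mark changed and keeps
the choice measurable. -/
lemma exists_raisedMark {r : ℝ≥0∞} {ε : ℝ≥0} (hε : 0 < ε) {ω : Ω} (h : gap A V ω < r) :
    ∃ n, A n ω < raisedMark A V r ε n ω ∧
      ENNReal.ofReal |raisedMark A V r ε n ω - V n ω| ≤ gap A V ω + ε + ε ∧
      ∀ j ≠ n, raisedMark A V r ε j ω = V j ω := by
  classical
  have h1 : gap A V ω < min r (gap A V ω + ε) :=
    lt_min h (ENNReal.lt_add_right (gap_lt_top A V ω).ne (by exact_mod_cast hε.ne'))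
  have hex : ∃ n, ENNReal.ofReal (A n ω - V n ω) < min r (gap A V ω + ε) := iInf_lt_iff.1 h1
  have hval : raisedMark A V r ε (Nat.find hex) ω =
      max (V (Nat.find hex) ω) (A (Nat.find hex) ω + ε) :=
    if_pos ⟨Nat.find_spec hex, fun j hj => Nat.find_min hex hj⟩
  refine ⟨Nat.find hex, ?_, ?_, fun j hj => if_neg fun H => ?_⟩
  · rw [hval]
    exact lt_max_of_lt_right (lt_add_of_pos_right _ hε)
  · rw [hval]
    have h2 := (Nat.find_spec hex).le.trans (min_le_right _ _)
    refine le_trans ?_ (add_le_add_left h2 _)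
    rcases le_total (V (Nat.find hex) ω) (A (Nat.find hex) ω + ε) with h3 | h3
    · rw [max_eq_right h3, abs_of_nonneg (sub_nonneg.2 h3), add_sub_right_comm]
      exact ENNReal.ofReal_add_le.trans (by rw [ENNReal.ofReal_coe_nnreal])
    · rw [max_eq_left h3, sub_self, abs_zero, ENNReal.ofReal_zero]
      exact zero_le
  · rcases lt_or_gt_of_ne hj with h3 | h3
    · exact Nat.find_min hex h3 H.1
    · exact H.2 _ h3 (Nat.find_spec hex)

lemma matchingCost_raisedMark_le {r : ℝ≥0∞} {ε : ℝ≥0} (hε : 0 < ε) (ω : Ω) :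
    matchingCost (baseline A (raisedMark A V r ε) ω) (baseline A V ω) ≤
      {ω | gap A V ω < r}.indicator (fun ω => gap A V ω) ω + (ε + ε) := by
  refine (matchingCost_baseline_le A V (raisedMark A V r ε) ω).trans ?_
  by_cases h : gap A V ω < r
  · obtain ⟨n, -, hn, hj⟩ := exists_raisedMark hε h
    rw [tsum_eq_single n fun j hjn => by simp [hj j hjn],
      Set.indicator_of_mem (show ω ∈ {ω | gap A V ω < r} from h), ← add_assoc]
    exact hn
  · have : ∀ n, raisedMark A V r ε n ω = V n ω := fun n => if_neg fun H =>
      h ((iInf_le _ n).trans_lt (H.1.trans_le (min_le_left _ _)))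
    simp [this]

end configurations

/-! ### Weak duality and near-optimal laws in the Wasserstein ball -/

section ball

variable [MeasurableSpace Ω] {μ : Measure Ω} {A V : ℕ → Ω → ℝ}

lemma measurable_gap (hA : ∀ n, Measurable (A n)) (hV : ∀ n, Measurable (V n)) :
    Measurable (gap A V) :=
  Measurable.iInf fun n => ((hA n).sub (hV n)).ennreal_ofReal

/-- Weak duality. -/
lemma measure_le_gap_le_of_mem_ball [IsProbabilityMeasure μ] (hA : ∀ n, Measurable (A n))
    (hV : ∀ n, Measurable (V n)) {B : Set (ℝ × ℝ)} (hB : MeasurableSet B)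
    (hBle : ∀ z ∈ B, z.1 ≤ z.2) {δ r : ℝ≥0} (hr : 0 < r)
    (hδ : (δ : ℝ≥0∞) ≤ ∫⁻ ω in {ω | gap A V ω < r}, gap A V ω ∂μ) {P : Measure Config}
    (hP : P ∈ wassersteinBall (μ.map (baseline A V)) δ) :
    μ {ω | (r : ℝ≥0∞) ≤ gap A V ω} ≤ P {N | N.1 B = 0} := by
  have hgm := measurable_gap hA hV
  have hE := measurableSet_config_void hB
  have hmin : r * μ {ω | (r : ℝ≥0∞) ≤ gap A V ω} + δ ≤ ∫⁻ ω, min (gap A V ω) r ∂μ := by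
    rw [← lintegral_add_compl _ (measurableSet_le measurable_const hgm :
      MeasurableSet {ω | (r : ℝ≥0∞) ≤ gap A V ω})]
    refine add_le_add ?_ (hδ.trans ?_)
    · rw [← setLIntegral_const]
      exact setLIntegral_mono' (measurableSet_le measurable_const hgm) fun ω hω => le_min hω le_rfl
    · have : {ω | (r : ℝ≥0∞) ≤ gap A V ω}ᶜ = {ω | gap A V ω < r} := by ext; simp
      rw [this]
      exact setLIntegral_mono' (measurableSet_lt hgm measurable_const)
        fun ω hω => le_min le_rfl (le_of_lt hω)
  -- The slack `ε` is there because an optimal coupling need not be available.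
  have key : ∀ ε : ℝ≥0, 0 < ε → r * μ {ω | (r : ℝ≥0∞) ≤ gap A V ω} ≤
      r * P {N | N.1 B = 0} + ε := by
    intro ε hε
    have hlt : wasserstein P (μ.map (baseline A V)) < δ + ε :=
      hP.2.trans_lt (ENNReal.lt_add_right ENNReal.coe_ne_top (by exact_mod_cast hε.ne'))
    simp only [wasserstein, iInf_lt_iff] at hlt
    obtain ⟨γ, hγ1, hγ2, hγ⟩ := hlt
    -- Dual feasibility: if `B` is charged, the cost alone dominates the gap; otherwise the term `r`
    -- dominates the minimum.
    have hpt : ∀ z : Config × Config, min (configGap z.2) r ≤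
        r * ({N : Config | N.1 B = 0}.indicator 1 z.1) + matchingCost z.1 z.2 := by
      intro z
      by_cases hz : z.1.1 B = 0
      · rw [Set.indicator_of_mem (show z.1 ∈ {N : Config | N.1 B = 0} from hz)]
        simp
      · refine (min_le_left _ _).trans ((configGap_le_matchingCost fun h0 => hz ?_).trans
          le_add_self)
        exact measure_mono_null hBle h0
    have hI : Measurable fun z : Config × Config =>
        {N : Config | N.1 B = 0}.indicator (1 : Config → ℝ≥0∞) z.1 :=
      (measurable_one.indicator hE).comp measurable_fst
    have h1 : ∫⁻ ω, min (gap A V ω) r ∂μ = ∫⁻ z, min (configGap z.2) r ∂γ := by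
      rw [← lintegral_map (f := fun N => min (configGap N) r)
        (measurable_configGap.min measurable_const) measurable_snd, hγ2,
        lintegral_map (measurable_configGap.min measurable_const) (measurable_baseline hA hV)]
      simp only [configGap_baseline]
    have h2 : ∫⁻ z : Config × Config, r * ({N : Config | N.1 B = 0}.indicator 1 z.1) ∂γ =
        r * P {N | N.1 B = 0} := by
      rw [lintegral_const_mul _ hI, ← hγ1,
        ← lintegral_map (f := {N : Config | N.1 B = 0}.indicator 1) (measurable_one.indicator hE)
        measurable_fst, lintegral_indicator_one hE]
    have h3 : ∫⁻ ω, min (gap A V ω) r ∂μ ≤ r * P {N | N.1 B = 0} + (δ + ε) := by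
      rw [h1]
      refine (lintegral_mono hpt).trans ?_
      rw [lintegral_add_left (hI.const_mul _), h2]
      gcongr
    have h4 := hmin.trans h3
    rw [show (r : ℝ≥0∞) * P {N | N.1 B = 0} + (δ + ε) = r * P {N | N.1 B = 0} + ε + δ by ring] at h4
    exact (ENNReal.add_le_add_iff_right ENNReal.coe_ne_top).1 h4
  have := ENNReal.le_of_forall_pos_le_add fun ε hε _ => key ε hε
  exact (ENNReal.mul_le_mul_iff_right (by exact_mod_cast hr.ne') ENNReal.coe_ne_top).1 this

lemma measurable_raisedMark (hA : ∀ n, Measurable (A n)) (hV : ∀ n, Measurable (V n))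
    (r : ℝ≥0∞) (ε : ℝ≥0) (n : ℕ) : Measurable (raisedMark A V r ε n) := by
  have h1 : ∀ j, MeasurableSet {ω | ENNReal.ofReal (A j ω - V j ω) < min r (gap A V ω + ε)} :=
    fun j => measurableSet_lt ((hA j).sub (hV j)).ennreal_ofReal
      (measurable_const.min ((measurable_gap hA hV).add_const _))
  refine Measurable.ite ((h1 n).inter ?_) ((hV n).max ((hA n).add_const _)) (hV n)
  change MeasurableSet {ω | ∀ j < n,
    ¬ ENNReal.ofReal (A j ω - V j ω) < min r (gap A V ω + ε)}
  simp only [Set.ofPred_forall]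
  exact MeasurableSet.iInter fun j => MeasurableSet.iInter fun _ => (h1 j).compl

/-- Near-optimal laws in the Wasserstein ball, for a positive radius. -/
lemma exists_mem_ball_le [IsProbabilityMeasure μ] (hA : ∀ n, Measurable (A n))
    (hV : ∀ n, Measurable (V n)) {B : Set (ℝ × ℝ)} (hB : MeasurableSet B)
    (hBup : ∀ᵐ ω ∂μ, ∀ n v, A n ω < v → (A n ω, v) ∈ B) {δ : ℝ≥0} {r : ℝ≥0∞} (hδ : 0 < δ)
    (hle : ∫⁻ ω in {ω | gap A V ω < r}, gap A V ω ∂μ ≤ δ) {t : ℝ≥0} (ht : 0 < t) (ht1 : t ≤ 1) :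
    ∃ P ∈ wassersteinBall (μ.map (baseline A V)) δ,
      P {N | N.1 B = 0} ≤ μ {ω | r ≤ gap A V ω} + t := by
  -- Mixing in the baseline with weight `t` scales the cost δ + 2ε by 1 - t. This `ε` makes the
  -- total (1 - t)(1 + t)δ ≤ δ.
  set ε : ℝ≥0 := t * δ / 2 with hεdef
  have hε : 0 < ε := by positivity
  have hgm := measurable_gap hA hV
  set V' := raisedMark A V r ε with hV'
  have hb := measurable_baseline hA hV
  have hb' : Measurable (baseline A V') := measurable_baseline hA (measurable_raisedMark hA hV r ε)
  set γ : Measure (Config × Config) :=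
    ((1 - t : ℝ≥0) : ℝ≥0∞) • μ.map (fun ω => (baseline A V' ω, baseline A V ω)) +
      (t : ℝ≥0∞) • μ.map (fun ω => (baseline A V ω, baseline A V ω)) with hγ
  have hsum : ((1 - t : ℝ≥0) : ℝ≥0∞) + t = 1 := by
    rw [← ENNReal.coe_add, tsub_add_cancel_of_le ht1, ENNReal.coe_one]
  have hfst : γ.map Prod.fst = ((1 - t : ℝ≥0) : ℝ≥0∞) • μ.map (baseline A V') +
      (t : ℝ≥0∞) • μ.map (baseline A V) := by
    rw [hγ, Measure.map_add _ _ measurable_fst, Measure.map_smul, Measure.map_smul,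
      Measure.map_map measurable_fst (hb'.prodMk hb), Measure.map_map measurable_fst (hb.prodMk hb)]
    rfl
  have hsnd : γ.map Prod.snd = μ.map (baseline A V) := by
    rw [hγ, Measure.map_add _ _ measurable_snd, Measure.map_smul, Measure.map_smul,
      Measure.map_map measurable_snd (hb'.prodMk hb), Measure.map_map measurable_snd (hb.prodMk hb)]
    change ((1 - t : ℝ≥0) : ℝ≥0∞) • μ.map (baseline A V) + (t : ℝ≥0∞) • μ.map (baseline A V) = _
    rw [← add_smul, hsum, one_smul]
  have hcost1 : ∫⁻ z, matchingCost z.1 z.2 ∂(μ.map fun ω => (baseline A V' ω, baseline A V ω)) ≤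
      δ + (ε + ε) := by
    -- This inequality holds for arbitrary integrands, so no measurability of the matching cost is
    -- required.
    refine (lintegral_map_le _ _).trans ((lintegral_mono (matchingCost_raisedMark_le hε)).trans ?_)
    rw [lintegral_add_right _ measurable_const, lintegral_indicator
      (measurableSet_lt hgm measurable_const), lintegral_const, measure_univ, mul_one]
    gcongr
  have hcost2 : ∫⁻ z, matchingCost z.1 z.2 ∂(μ.map fun ω => (baseline A V ω, baseline A V ω)) = 0 := by
    refine le_antisymm ((lintegral_map_le _ _).trans ((lintegral_mono (g := fun _ => 0)
      fun ω => (matchingCost_baseline_le A V V ω).trans (by simp)).trans (by simp))) zero_le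
  refine ⟨γ.map Prod.fst, ⟨⟨?_⟩, ?_⟩, ?_⟩
  · have := Measure.isProbabilityMeasure_map (μ := μ) hb.aemeasurable
    have := Measure.isProbabilityMeasure_map (μ := μ) hb'.aemeasurable
    rw [hfst]
    simp only [Measure.coe_add, Measure.coe_smul, Pi.add_apply, Pi.smul_apply, measure_univ,
      smul_eq_mul, mul_one, hsum]
  · refine (iInf_le_of_le γ (iInf₂_le rfl hsnd)).trans ?_
    rw [hγ, lintegral_add_measure, lintegral_smul_measure, lintegral_smul_measure, hcost2, smul_zero,
      add_zero, smul_eq_mul]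
    refine (mul_le_mul_right hcost1 _).trans ?_
    norm_cast
    rw [← NNReal.coe_le_coe]
    push_cast [hεdef, NNReal.coe_sub ht1]
    nlinarith [mul_nonneg (mul_nonneg t.coe_nonneg t.coe_nonneg) δ.coe_nonneg]
  · rw [hfst, Measure.add_apply, Measure.smul_apply, Measure.smul_apply, smul_eq_mul, smul_eq_mul,
      Measure.map_apply hb' (measurableSet_config_void hB)]
    have := Measure.isProbabilityMeasure_map (μ := μ) hb.aemeasurable
    refine add_le_add ((mul_le_of_le_one_left' ?_).trans ?_) (mul_le_of_le_one_right' prob_le_one)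
    · exact_mod_cast tsub_le_self
    · refine measure_mono_ae ?_
      filter_upwards [hBup] with ω hω (h : (baseline A V' ω).1 B = 0)
      by_contra hr
      obtain ⟨n, hn, -⟩ := exists_raisedMark hε (not_le.1 hr)
      exact (baseline_eq_zero_iff _ _ _ hB).1 h n (hω n _ hn)

/-- The worst-case void probability over the Wasserstein ball, given the first-order condition of
the dual problem. -/
theorem iInf_ball_eq [IsProbabilityMeasure μ] (hA : ∀ n, Measurable (A n))
    (hV : ∀ n, Measurable (V n)) {B : Set (ℝ × ℝ)} (hB : MeasurableSet B)
    (hBle : ∀ z ∈ B, z.1 ≤ z.2) (hBup : ∀ᵐ ω ∂μ, ∀ n v, A n ω < v → (A n ω, v) ∈ B)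
    {δ : ℝ≥0} {r : ℝ≥0∞} (hr : 0 < r)
    (hpos : μ {ω | ∀ n, V n ω ≤ A n ω} ≤ μ {ω | 0 < gap A V ω})
    (hle : ∫⁻ ω in {ω | gap A V ω < r}, gap A V ω ∂μ ≤ δ)
    (hge : r ≠ ⊤ → δ ≤ ∫⁻ ω in {ω | gap A V ω < r}, gap A V ω ∂μ) :
    ⨅ P ∈ wassersteinBall (μ.map (baseline A V)) δ, P {N | N.1 B = 0} =
      μ {ω | r ≤ gap A V ω} := by
  have hgm := measurable_gap hA hV
  have hb := measurable_baseline hA hV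
  refine le_antisymm ?_ (le_iInf₂ fun P hP => ?_)
  -- At radius zero no overshoot is affordable, so the baseline law itself is used. Then `hle`
  -- forces the gap to vanish a.s. below `r`, and `hpos` discards configurations that only touch the
  -- diagonal.
  · rcases eq_zero_or_pos δ with rfl | hδ
    · have hmem : μ.map (baseline A V) ∈ wassersteinBall (μ.map (baseline A V)) 0 := by
        refine ⟨Measure.isProbabilityMeasure_map hb.aemeasurable, ?_⟩
        refine (iInf_le_of_le (μ.map fun ω => (baseline A V ω, baseline A V ω)) (iInf₂_le
          (Measure.map_map measurable_fst (hb.prodMk hb))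
          (Measure.map_map measurable_snd (hb.prodMk hb)))).trans ?_
        refine (lintegral_map_le _ _).trans ((lintegral_mono (g := fun _ => 0)
          fun ω => (matchingCost_baseline_le A V V ω).trans (by simp)).trans (by simp))
      refine (iInf₂_le _ hmem).trans ?_
      rw [Measure.map_apply hb (measurableSet_config_void hB)]
      calc _ ≤ μ {ω | ∀ n, V n ω ≤ A n ω} := measure_mono_ae (by
            filter_upwards [hBup] with ω hω (h : (baseline A V ω).1 B = 0) n
            by_contra hn
            exact (baseline_eq_zero_iff _ _ _ hB).1 h n (hω n _ (not_le.1 hn)))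
        _ ≤ μ {ω | 0 < gap A V ω} := hpos
        _ ≤ _ := measure_mono_ae (by
            have h0 : ∫⁻ ω in {ω | gap A V ω < r}, gap A V ω ∂μ = 0 := by simpa using hle
            rw [lintegral_eq_zero_iff hgm, Filter.EventuallyEq,
              ae_restrict_iff' (measurableSet_lt hgm measurable_const)] at h0
            filter_upwards [h0] with ω hω (h : 0 < gap A V ω)
            by_contra hn
            exact h.ne' (hω (not_le.1 hn)))
    · refine ENNReal.le_of_forall_pos_le_add fun t ht _ => ?_
      obtain ⟨P, hP, hPle⟩ := exists_mem_ball_le (t := min t 1) hA hV hB hBup hδ hle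
        (lt_min ht one_pos) (min_le_right _ _)
      refine (iInf₂_le P hP).trans (hPle.trans ?_)
      gcongr
      exact min_le_left _ _
  · rcases eq_or_ne r ⊤ with rfl | hrt
    · have : {ω | ⊤ ≤ gap A V ω} = ∅ :=
        Set.eq_empty_of_forall_notMem fun ω h => (gap_lt_top A V ω).not_ge h
      rw [this, measure_empty]
      exact zero_le
    · lift r to ℝ≥0 using hrt
      exact measure_le_gap_le_of_mem_ball hA hV hB hBle (by exact_mod_cast hr)
        (hge ENNReal.coe_ne_top) hP

end ball

end

/-! ### The dual objective and its first-order condition -/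

section

variable {Ω : Type*} [MeasurableSpace Ω] {μ : Measure Ω} {A V : ℕ → Ω → ℝ}

lemma dualObjective_eq (δ lam : ℝ≥0) :
    dualObjective μ A V δ lam =
      lam * δ + ∫ ω, max (1 - lam * (gap A V ω).toReal) 0 ∂μ := by
  simp only [dualObjective, toReal_gap]

variable [IsProbabilityMeasure μ]

lemma integrable_dual_integrand (hA : ∀ n, Measurable (A n)) (hV : ∀ n, Measurable (V n))
    (l : ℝ≥0) : Integrable (fun ω => max (1 - (l : ℝ) * (gap A V ω).toReal) 0) μ := by
  have hm := (measurable_gap hA hV).ennreal_toReal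
  refine Integrable.of_bound (C := 1)
    ((measurable_const.sub (hm.const_mul _)).max measurable_const).aestronglyMeasurable
    (ae_of_all _ fun ω => ?_)
  rw [Real.norm_of_nonneg (le_max_right _ _)]
  have : 0 ≤ (l : ℝ) * (gap A V ω).toReal := by positivity
  exact max_le (by linarith) zero_le_one

lemma continuous_dualObjective (hA : ∀ n, Measurable (A n)) (hV : ∀ n, Measurable (V n))
    (δ : ℝ≥0) : Continuous (dualObjective μ A V δ) := by
  have h : dualObjective μ A V δ = fun lam : ℝ≥0 =>
      lam * δ + ∫ ω, max (1 - (lam : ℝ) * (gap A V ω).toReal) 0 ∂μ :=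
    funext fun lam => dualObjective_eq δ lam
  rw [h]
  refine (by fun_prop : Continuous fun lam : ℝ≥0 => (lam : ℝ) * (δ : ℝ)).add ?_
  refine continuous_of_dominated (bound := fun _ => 1)
    (fun l => (integrable_dual_integrand hA hV l).aestronglyMeasurable)
    (fun l => ae_of_all _ fun ω => ?_) (integrable_const 1) (ae_of_all _ fun ω => by fun_prop)
  rw [Real.norm_of_nonneg (le_max_right _ _)]
  have : 0 ≤ (l : ℝ) * (gap A V ω).toReal := by positivity
  exact max_le (by linarith) zero_le_one

/-- Beyond 1/δ the linear term alone is at least 1, the value at `0`, so minimizing over a compact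
interval suffices. -/
lemma exists_isMinOn_dualObjective (hA : ∀ n, Measurable (A n)) (hV : ∀ n, Measurable (V n))
    {δ : ℝ≥0} (hδ : 0 < δ) : ∃ lam : ℝ≥0, IsMinOn (dualObjective μ A V δ) Set.univ lam := by
  obtain ⟨lam, -, hlam⟩ := (isCompact_Icc (a := (0 : ℝ≥0)) (b := δ⁻¹)).exists_isMinOn
    ⟨0, by simp⟩ (continuous_dualObjective (μ := μ) hA hV δ).continuousOn
  refine ⟨lam, fun l _ => ?_⟩
  rcases le_or_gt l δ⁻¹ with hl | hl
  · exact hlam ⟨zero_le, hl⟩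
  · have h00 : dualObjective μ A V δ lam ≤ dualObjective μ A V δ 0 :=
      hlam (show (0 : ℝ≥0) ∈ Set.Icc 0 δ⁻¹ by simp)
    refine h00.trans ?_
    have h0 : dualObjective μ A V δ 0 = 1 := by simp [dualObjective]
    rw [h0, dualObjective_eq]
    have h1 : (1 : ℝ) ≤ l * δ := by
      have h2 : δ⁻¹ * δ ≤ l * δ := mul_le_mul_left hl.le _
      rw [inv_mul_cancel₀ hδ.ne'] at h2
      exact_mod_cast h2
    have h3 : 0 ≤ ∫ ω, max (1 - (l : ℝ) * (gap A V ω).toReal) 0 ∂μ :=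
      integral_nonneg fun _ => le_max_right _ _
    linarith

/-- A subgradient inequality for the dual objective. -/
lemma dualObjective_sub_le (hA : ∀ n, Measurable (A n)) (hV : ∀ n, Measurable (V n)) (δ : ℝ≥0)
    {l : ℝ≥0} (hl : 0 < l) (lam : ℝ≥0) :
    dualObjective μ A V δ l - dualObjective μ A V δ lam ≤ ((lam : ℝ) - l) *
      ((∫⁻ ω in {ω | gap A V ω < (l : ℝ≥0∞)⁻¹}, gap A V ω ∂μ).toReal - δ) := by
  have hgm := measurable_gap hA hV
  set S : Set Ω := {ω | gap A V ω < (l : ℝ≥0∞)⁻¹} with hS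
  have hSm : MeasurableSet S := measurableSet_lt hgm measurable_const
  have hmem : ∀ ω, ω ∈ S ↔ (l : ℝ) * (gap A V ω).toReal < 1 := fun ω => by
    rw [hS, Set.mem_ofPred_eq, ← ENNReal.coe_inv hl.ne', ← ENNReal.toReal_lt_toReal
      (gap_lt_top A V ω).ne ENNReal.coe_ne_top, ENNReal.coe_toReal, NNReal.coe_inv,
      ← one_div, lt_div_iff₀' (by exact_mod_cast hl)]
  have hint : ∫ ω, S.indicator (fun ω => (gap A V ω).toReal) ω ∂μ =
      (∫⁻ ω in S, gap A V ω ∂μ).toReal := by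
    rw [integral_indicator hSm, integral_toReal hgm.aemeasurable (ae_of_all _ (gap_lt_top A V))]
  have hI : Integrable (S.indicator fun ω => (gap A V ω).toReal) μ := by
    refine Integrable.of_bound (C := (l : ℝ)⁻¹) (hgm.ennreal_toReal.indicator hSm).aestronglyMeasurable
      (ae_of_all _ fun ω => ?_)
    by_cases hω : ω ∈ S
    · rw [Set.indicator_of_mem hω, Real.norm_of_nonneg ENNReal.toReal_nonneg, ← one_div,
        le_div_iff₀' (by exact_mod_cast hl)]
      exact ((hmem ω).1 hω).le
    · rw [Set.indicator_of_notMem hω, norm_zero]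
      positivity
  have hle : ∫ ω, max (1 - (l : ℝ) * (gap A V ω).toReal) 0 ∂μ -
      ∫ ω, max (1 - (lam : ℝ) * (gap A V ω).toReal) 0 ∂μ ≤
      ((lam : ℝ) - l) * (∫⁻ ω in S, gap A V ω ∂μ).toReal := by
    rw [← integral_sub (integrable_dual_integrand hA hV l) (integrable_dual_integrand hA hV lam),
      ← hint, ← integral_const_mul]
    refine integral_mono ((integrable_dual_integrand hA hV l).sub
      (integrable_dual_integrand hA hV lam)) (hI.const_mul _) fun ω => ?_
    simp only
    -- On `S` the hinge at `l` is its linear piece and the hinge at `lam` lies above its own; off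
    -- `S` the hinge at `l` vanishes.
    by_cases hω : ω ∈ S
    · have h1 := (hmem ω).1 hω
      rw [Set.indicator_of_mem hω, max_eq_left (by linarith)]
      have h2 := le_max_left (1 - (lam : ℝ) * (gap A V ω).toReal) 0
      linarith
    · have h1 := not_lt.1 (mt (hmem ω).2 hω)
      rw [Set.indicator_of_notMem hω, max_eq_right (by linarith)]
      have h2 := le_max_right (1 - (lam : ℝ) * (gap A V ω).toReal) 0
      linarith
  rw [dualObjective_eq, dualObjective_eq]
  linarith

section minimizer

variable {δ lam : ℝ≥0}

lemma setLIntegral_gap_ne_top (r : ℝ≥0) :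
    ∫⁻ ω in {ω | gap A V ω < r}, gap A V ω ∂μ ≠ ⊤ := by
  have h : ∫⁻ ω in {ω | gap A V ω < r}, gap A V ω ∂μ ≤ ∫⁻ _ in {ω | gap A V ω < r}, r ∂μ :=
    setLIntegral_mono measurable_const fun ω (hω : gap A V ω < r) => hω.le
  rw [setLIntegral_const] at h
  exact (h.trans_lt (ENNReal.mul_lt_top ENNReal.coe_lt_top (measure_lt_top _ _))).ne

/-- The subgradient inequality is used at 1/r > λ rather than at λ, where it would say nothing;
minimality then fixes the sign of the slope. -/
lemma setLIntegral_gap_lt_le (hA : ∀ n, Measurable (A n)) (hV : ∀ n, Measurable (V n))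
    (hmin : IsMinOn (dualObjective μ A V δ) Set.univ lam) {r : ℝ≥0} (hr : 0 < r)
    (hlt : (r : ℝ≥0∞) < (lam : ℝ≥0∞)⁻¹) :
    ∫⁻ ω in {ω | gap A V ω < r}, gap A V ω ∂μ ≤ δ := by
  have h1 := dualObjective_sub_le (μ := μ) hA hV δ (inv_pos.2 hr) lam
  have h2 : dualObjective μ A V δ lam ≤ dualObjective μ A V δ r⁻¹ := hmin (Set.mem_univ _)
  rw [ENNReal.coe_inv hr.ne', inv_inv] at h1
  have h3 : (lam : ℝ) < (r⁻¹ : ℝ≥0) := by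
    have := ENNReal.lt_inv_iff_lt_inv.1 hlt
    rw [← ENNReal.coe_inv hr.ne'] at this
    exact_mod_cast this
  have h4 : (∫⁻ ω in {ω | gap A V ω < r}, gap A V ω ∂μ).toReal ≤ δ := by
    by_contra! h
    have := mul_neg_of_neg_of_pos (sub_neg.2 h3) (sub_pos.2 h)
    linarith
  rw [← ENNReal.ofReal_toReal (setLIntegral_gap_ne_top r), ← ENNReal.ofReal_coe_nnreal (p := δ)]
  exact ENNReal.ofReal_le_ofReal h4

lemma le_setLIntegral_gap_lt (hA : ∀ n, Measurable (A n)) (hV : ∀ n, Measurable (V n))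
    (hmin : IsMinOn (dualObjective μ A V δ) Set.univ lam) {r : ℝ≥0}
    (hlt : (lam : ℝ≥0∞)⁻¹ < r) :
    δ ≤ ∫⁻ ω in {ω | gap A V ω < r}, gap A V ω ∂μ := by
  have hr : 0 < r := by exact_mod_cast zero_le.trans_lt hlt
  have h1 := dualObjective_sub_le (μ := μ) hA hV δ (inv_pos.2 hr) lam
  have h2 : dualObjective μ A V δ lam ≤ dualObjective μ A V δ r⁻¹ := hmin (Set.mem_univ _)
  rw [ENNReal.coe_inv hr.ne', inv_inv] at h1
  have h3 : ((r⁻¹ : ℝ≥0) : ℝ) < lam := by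
    have := ENNReal.inv_lt_iff_inv_lt.1 hlt
    rw [← ENNReal.coe_inv hr.ne'] at this
    exact_mod_cast this
  have h4 : δ ≤ (∫⁻ ω in {ω | gap A V ω < r}, gap A V ω ∂μ).toReal := by
    by_contra! h
    have := mul_neg_of_pos_of_neg (sub_pos.2 h3) (sub_neg.2 h)
    linarith
  rw [← ENNReal.ofReal_toReal (setLIntegral_gap_ne_top r), ← ENNReal.ofReal_coe_nnreal (p := δ)]
  exact ENNReal.ofReal_le_ofReal h4

/-- Thresholds increasing strictly to 1/λ exhaust {D < 1/λ}, so atoms do no harm. The case λ = 0 is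
included, with limit ∞. -/
lemma setLIntegral_gap_le (hA : ∀ n, Measurable (A n)) (hV : ∀ n, Measurable (V n))
    (hmin : IsMinOn (dualObjective μ A V δ) Set.univ lam) :
    ∫⁻ ω in {ω | gap A V ω < (lam : ℝ≥0∞)⁻¹}, gap A V ω ∂μ ≤ δ := by
  have hgm := measurable_gap hA hV
  have hpos : 0 < (lam : ℝ≥0∞)⁻¹ := by simp
  obtain ⟨u, hu, hmem, hlim⟩ := exists_seq_strictMono_tendsto' hpos
  have hset : {ω | gap A V ω < (lam : ℝ≥0∞)⁻¹} = ⋃ n, {ω | gap A V ω < u n} := by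
    ext ω
    simp only [Set.mem_ofPred_eq, Set.mem_iUnion]
    refine ⟨fun h => (hlim.eventually (lt_mem_nhds h)).exists, fun ⟨n, hn⟩ => hn.trans (hmem n).2⟩
  have htend := tendsto_measure_iUnion_atTop (μ := μ.withDensity (gap A V))
    (s := fun n => {ω | gap A V ω < u n})
    (fun m n hmn ω (h : _ < u m) => h.trans_le (hu.monotone hmn))
  rw [← hset, withDensity_apply _ (measurableSet_lt hgm measurable_const)] at htend
  refine le_of_tendsto' htend fun n => ?_
  simp only [Function.comp_apply]
  rw [withDensity_apply _ (measurableSet_lt hgm measurable_const)]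
  have hn : u n ≠ ⊤ := ((hmem n).2.trans_le le_top).ne
  have h1 := hmem n
  lift u n to ℝ≥0 using hn with v hv
  exact setLIntegral_gap_lt_le hA hV hmin (by exact_mod_cast h1.1) h1.2

/-- Thresholds decreasing to 1/λ only reach {D ≤ 1/λ}. The hypothesis `hnull` says that D has no
atom there, which restores the strict inequality. -/
lemma le_setLIntegral_gap (hA : ∀ n, Measurable (A n)) (hV : ∀ n, Measurable (V n))
    (hmin : IsMinOn (dualObjective μ A V δ) Set.univ lam) (hlam : (lam : ℝ≥0∞)⁻¹ ≠ ⊤)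
    (hnull : μ {ω | (lam : ℝ≥0∞)⁻¹ ≤ gap A V ω} ≤ μ {ω | (lam : ℝ≥0∞)⁻¹ < gap A V ω}) :
    δ ≤ ∫⁻ ω in {ω | gap A V ω < (lam : ℝ≥0∞)⁻¹}, gap A V ω ∂μ := by
  have hgm := measurable_gap hA hV
  obtain ⟨u, hu, hmem, hlim⟩ := exists_seq_strictAnti_tendsto' (lt_top_iff_ne_top.2 hlam)
  have hset : {ω | gap A V ω ≤ (lam : ℝ≥0∞)⁻¹} = ⋂ n, {ω | gap A V ω < u n} := by
    ext ω
    simp only [Set.mem_ofPred_eq, Set.mem_iInter]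
    exact ⟨fun h n => h.trans_lt (hmem n).1, fun h => ge_of_tendsto' hlim fun n => (h n).le⟩
  have hae : ({ω | gap A V ω < (lam : ℝ≥0∞)⁻¹} : Set Ω) =ᵐ[μ] {ω | gap A V ω ≤ (lam : ℝ≥0∞)⁻¹} := by
    have h1 := ae_eq_of_subset_of_measure_ge (s := {ω | (lam : ℝ≥0∞)⁻¹ < gap A V ω})
      (t := {ω | (lam : ℝ≥0∞)⁻¹ ≤ gap A V ω})
      (fun ω (h : (lam : ℝ≥0∞)⁻¹ < gap A V ω) => h.le) hnull
      (measurableSet_lt measurable_const hgm).nullMeasurableSet (measure_ne_top _ _)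
    have h2 : ({ω | gap A V ω < (lam : ℝ≥0∞)⁻¹} : Set Ω) = {ω | (lam : ℝ≥0∞)⁻¹ ≤ gap A V ω}ᶜ := by
      ext; simp
    have h3 : ({ω | gap A V ω ≤ (lam : ℝ≥0∞)⁻¹} : Set Ω) = {ω | (lam : ℝ≥0∞)⁻¹ < gap A V ω}ᶜ := by
      ext; simp
    rw [h2, h3]
    exact h1.symm.compl
  rw [setLIntegral_congr hae]
  have hmeas : ∀ n, MeasurableSet {ω | gap A V ω < u n} := fun n =>
    measurableSet_lt hgm measurable_const
  have hnt : ∀ n, ∃ v : ℝ≥0, (v : ℝ≥0∞) = u n := fun n => ⟨(u n).toNNReal, ENNReal.coe_toNNReal (hmem n).2.ne⟩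
  have htend := tendsto_measure_iInter_atTop (μ := μ.withDensity (gap A V))
    (s := fun n => {ω | gap A V ω < u n}) (fun n => (hmeas n).nullMeasurableSet)
    (fun m n hmn ω (h : _ < u n) => h.trans_le (hu.antitone hmn))
    ⟨0, by
      obtain ⟨v, hv⟩ := hnt 0
      rw [withDensity_apply _ (hmeas 0), ← hv]
      exact setLIntegral_gap_ne_top v⟩
  rw [← hset, withDensity_apply _ (measurableSet_le hgm measurable_const)] at htend
  refine ge_of_tendsto' htend fun n => ?_
  simp only [Function.comp_apply]
  rw [withDensity_apply _ (hmeas n)]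
  have h1 := hmem n
  obtain ⟨v, hv⟩ := hnt n
  rw [← hv] at h1 ⊢
  exact le_setLIntegral_gap_lt hA hV hmin h1.1

end minimizer

end

/-! ### The law of the gap and the absence of atoms -/

section

variable {Ω : Type*} [MeasurableSpace Ω] {μ : Measure Ω}

lemma ae_pos_of_map_eq_expMeasure {X : Ω → ℝ} (hX : Measurable X) (h : μ.map X = expMeasure 1) :
    ∀ᵐ ω ∂μ, 0 < X ω := by
  have h0 : ∀ᵐ s ∂expMeasure 1, 0 < s := by
    have h1 : expMeasure 1 = volume.withDensity (exponentialPDF 1) := rfl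
    have h2 := lintegral_exponentialPDF_of_nonpos (r := 1) le_rfl
    rw [ae_iff, h1]
    simp only [not_lt]
    change volume.withDensity (exponentialPDF 1) (Set.Iic 0) = 0
    rw [withDensity_apply _ measurableSet_Iic, ← setLIntegral_congr Iio_ae_eq_Iic]
    exact h2
  rw [← h] at h0
  exact ae_of_ae_map hX.aemeasurable h0

lemma ae_arrival_pos {ξ : ℕ → Ω → ℝ} (hξm : ∀ n, Measurable (ξ n))
    (hξlaw : ∀ n, μ.map (ξ n) = expMeasure 1) : ∀ᵐ ω ∂μ, ∀ n, 0 < arrival ξ n ω := by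
  filter_upwards [ae_all_iff.2 fun n => ae_pos_of_map_eq_expMeasure (hξm n) (hξlaw n)] with ω hω n
  exact Finset.sum_pos (fun i _ => hω i) ⟨0, by simp⟩

lemma lintegral_shiftedRegion_coe {A V : ℕ → Ω → ℝ} (hA : ∀ n, Measurable (A n))
    (hV : ∀ n, Measurable (V n)) (r : ℝ≥0) :
    ∫⁻ N, N.1 (shiftedRegion (r : ℝ≥0∞)) ∂(μ.map (baseline A V)) =
      ∑' n, μ {ω | A n ω < V n ω + r} := by
  have hS := measurableSet_shiftedRegion_coe r
  rw [lintegral_map (measurable_config_apply hS) (measurable_baseline hA hV)]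
  simp only [baseline_apply _ _ _ hS]
  have hm : ∀ n, Measurable fun ω => (shiftedRegion (r : ℝ≥0∞)).indicator (1 : ℝ × ℝ → ℝ≥0∞)
      (A n ω, V n ω) := fun n => (measurable_one.indicator hS).comp ((hA n).prodMk (hV n))
  rw [lintegral_tsum fun n => (hm n).aemeasurable]
  refine tsum_congr fun n => ?_
  rw [← lintegral_indicator_one (measurableSet_lt (hA n) ((hV n).add_const _))]
  refine lintegral_congr fun ω => ?_
  have hiff : ω ∈ {ω | A n ω < V n ω + r} ↔ A n ω < V n ω + r := Iff.rfl
  by_cases h : A n ω < V n ω + r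
  · rw [Set.indicator_of_mem (mem_shiftedRegion_coe.2 h), Set.indicator_of_mem (hiff.2 h)]
    rfl
  · rw [Set.indicator_of_notMem (mt mem_shiftedRegion_coe.1 h), Set.indicator_of_notMem (mt hiff.1 h)]

variable [IsProbabilityMeasure μ]

/-- Every baseline configuration has infinitely many points; this is the case λ = 0, where the
worst-case value is 0. -/
lemma lintegral_shiftedRegion_top {A V : ℕ → Ω → ℝ} (hA : ∀ n, Measurable (A n))
    (hV : ∀ n, Measurable (V n)) :
    ∫⁻ N, N.1 (shiftedRegion ⊤) ∂(μ.map (baseline A V)) = ⊤ := by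
  rw [shiftedRegion_top, lintegral_map (measurable_config_apply MeasurableSet.univ)
    (measurable_baseline hA hV)]
  simp [baseline_apply _ _ _ MeasurableSet.univ]

section marked

variable {ξ V : ℕ → Ω → ℝ}

/-- The gap of a marked Poisson process has no atoms away from `0`, and marks on the diagonal
are negligible. -/
lemma measure_forall_le_arrival_le (hξm : ∀ n, Measurable (ξ n)) (hVm : ∀ n, Measurable (V n))
    (hξ : iIndepFun ξ μ) (hξlaw : ∀ n, μ.map (ξ n) = expMeasure 1)
    (hV : iIndepFun V μ) (hVlaw : ∀ n, IdentDistrib (V n) (V 0) μ μ)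
    (hξV : IndepFun (fun ω n => ξ n ω) (fun ω n => V n ω) μ) (r : ℝ≥0) :
    μ {ω | ∀ n, V n ω + r ≤ arrival ξ n ω} ≤ μ {ω | (r : ℝ≥0∞) < gap (arrival ξ) V ω} := by
  -- Raising the level by `ε` increases the mean count by at most `ε`, hence lowers the void
  -- probability by a factor of at least e^{-ε}.
  have key : ∀ ε : ℝ, 0 < ε → μ {ω | ∀ n, V n ω + r ≤ arrival ξ n ω} ≤
      ENNReal.ofReal (Real.exp ε) * μ {ω | (r : ℝ≥0∞) < gap (arrival ξ) V ω} := fun ε hε => by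
    set s : ℝ≥0 := r + ε.toNNReal with hs
    have hsr : (s : ℝ) = r + ε := by simp [hs, hε.le]
    have hlt : r < s := by
      rw [← NNReal.coe_lt_coe, hsr]
      linarith
    have h1 : μ {ω | ∀ n, V n ω + s ≤ arrival ξ n ω} ≤
        μ {ω | (r : ℝ≥0∞) < gap (arrival ξ) V ω} := measure_mono fun ω hω =>
      (show (r : ℝ≥0∞) < s by exact_mod_cast hlt).trans_le
        ((coe_le_gap_iff (zero_le.trans_lt hlt)).2 hω)
    refine le_trans ?_ (mul_le_mul_right h1 _)
    rw [measure_forall_le_arrival hξm hVm hξ hξlaw hV hVlaw hξV,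
      measure_forall_le_arrival hξm hVm hξ hξlaw hV hVlaw hξV, ← EReal.exp_coe, ← EReal.exp_add,
      EReal.exp_le_exp_iff]
    have h2 := exceedance_le_add (μ := μ) (V 0) (show (r : ℝ) ≤ s by exact_mod_cast hlt.le)
    rw [show (s : ℝ) - r = ε by rw [hsr]; ring] at h2
    generalize exceedance μ (V 0) s = x at h2
    generalize exceedance μ (V 0) r = y at h2
    induction y with
    | top => simp
    | coe y =>
      lift x to ℝ≥0 using (h2.trans_lt (by finiteness)).ne
      have h3 : x ≤ y + ε.toNNReal := by
        rw [ENNReal.ofReal] at h2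
        exact_mod_cast h2
      have h4 : (x : ℝ) ≤ y + ε := by
        have := NNReal.coe_le_coe.2 h3
        simpa [hε.le] using this
      have h5 : -(y : ℝ) ≤ ε + -x := by linarith
      change -((y : ℝ) : EReal) ≤ (ε : EReal) + -((x : ℝ) : EReal)
      exact_mod_cast h5
  have hlim : Filter.Tendsto (fun ε : ℝ => ENNReal.ofReal (Real.exp ε) *
      μ {ω | (r : ℝ≥0∞) < gap (arrival ξ) V ω}) (nhdsWithin 0 (Set.Ioi 0))
      (nhds (ENNReal.ofReal (Real.exp 0) * μ {ω | (r : ℝ≥0∞) < gap (arrival ξ) V ω})) := by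
    refine ENNReal.Tendsto.mul_const ?_ (Or.inr (measure_ne_top _ _))
    exact ((ENNReal.continuous_ofReal.comp Real.continuous_exp).tendsto 0).mono_left
      nhdsWithin_le_nhds
  simp only [Real.exp_zero, ENNReal.ofReal_one, one_mul] at hlim
  exact ge_of_tendsto hlim (Filter.eventually_of_mem self_mem_nhdsWithin key)

/-- The law of the gap of a marked Poisson process. -/
lemma measure_le_gap (hξm : ∀ n, Measurable (ξ n)) (hVm : ∀ n, Measurable (V n))
    (hξ : iIndepFun ξ μ) (hξlaw : ∀ n, μ.map (ξ n) = expMeasure 1)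
    (hV : iIndepFun V μ) (hVlaw : ∀ n, IdentDistrib (V n) (V 0) μ μ)
    (hξV : IndepFun (fun ω n => ξ n ω) (fun ω n => V n ω) μ) {r : ℝ≥0∞} (hr : 0 < r) :
    μ {ω | r ≤ gap (arrival ξ) V ω} = EReal.exp
      (-((∫⁻ N, N.1 (shiftedRegion r) ∂(μ.map (baseline (arrival ξ) V)) : ℝ≥0∞) : EReal)) := by
  rcases eq_or_ne r ⊤ with rfl | hrt
  · rw [lintegral_shiftedRegion_top (measurable_arrival hξm) hVm]
    have : {ω | ⊤ ≤ gap (arrival ξ) V ω} = ∅ :=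
      Set.eq_empty_of_forall_notMem fun ω h => (gap_lt_top _ V ω).not_ge h
    rw [this, measure_empty]
    simp
  · lift r to ℝ≥0 using hrt
    rw [lintegral_shiftedRegion_coe (measurable_arrival hξm) hVm,
      tsum_measure_exceed hξm hVm hξ hξlaw hVlaw hξV,
      ← measure_forall_le_arrival hξm hVm hξ hξlaw hV hVlaw hξV]
    congr 1
    ext ω
    exact coe_le_gap_iff (by exact_mod_cast hr)

end marked

end

/-! ### Componentwise maxima and the final assembly -/

lemma measurable_weightedMax {d : ℕ} (x : Fin d → ℝ) :
    Measurable fun y : Fin d → ℝ => ⨆ k, x k * y k :=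
  Measurable.iSup fun k => by fun_prop

lemma maxComponent_le_iff {Ω : Type*} {d : ℕ} (hd : 0 < d) {x : Fin d → ℝ} (hx : ∀ k, 0 < x k)
    (ξ : ℕ → Ω → ℝ) (Y : ℕ → Ω → Fin d → ℝ) {ω : Ω} (hω : ∀ n, 0 < arrival ξ n ω) :
    (∀ k, maxComponent ξ Y k ω ≤ (((x k)⁻¹ : ℝ) : EReal)) ↔
      ∀ n, mark x Y n ω ≤ arrival ξ n ω := by
  have : Nonempty (Fin d) := ⟨⟨0, hd⟩⟩
  simp only [maxComponent, iSup_le_iff, EReal.coe_le_coe_iff, mark]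
  rw [forall_comm]
  refine forall_congr' fun n => ?_
  rw [ciSup_le_iff (Set.finite_range _).bddAbove]
  refine forall_congr' fun k => ?_
  rw [div_le_iff₀ (hω n), inv_mul_eq_div, le_div_iff₀' (hx k)]

end MEV

theorem corollary2 {Ω : Type*} [MeasurableSpace Ω] (μ : Measure Ω) [IsProbabilityMeasure μ]
    (d : ℕ) (hd : 0 < d) (x : Fin d → ℝ) (hx : ∀ k, 0 < x k) (δ : ℝ≥0)
    (ξ : ℕ → Ω → ℝ) (Y : ℕ → Ω → Fin d → ℝ)
    (hξm : ∀ n, Measurable (ξ n)) (hYm : ∀ n, Measurable (Y n))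
    -- the interarrival times are i.i.d. standard exponential
    (hξ : iIndepFun ξ μ) (hξlaw : ∀ n, μ.map (ξ n) = expMeasure 1)
    -- the spectral vectors are i.i.d. and independent of the arrivals
    (hY : iIndepFun Y μ) (hYlaw : ∀ n, IdentDistrib (Y n) (Y 0) μ μ)
    (hξY : IndepFun (fun ω n => ξ n ω) (fun ω n => Y n ω) μ)
    (P₀ : Measure MEV.Config)
    (hP₀ : P₀ = μ.map (MEV.baseline (MEV.arrival ξ) (MEV.mark x Y))) :
    -- at the baseline law, `cdfProb` is the distribution function of the maximum
    MEV.cdfProb P₀ = μ {ω | ∀ k, MEV.maxComponent ξ Y k ω ≤ (((x k)⁻¹ : ℝ) : EReal)} ∧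
    -- the dual problem has a minimizer if the radius is positive
    (0 < δ → ∃ lam : ℝ≥0, IsMinOn
      (MEV.dualObjective μ (MEV.arrival ξ) (MEV.mark x Y) δ) Set.univ lam) ∧
    -- the worst-case value, at every minimizer of the dual problem
    ∀ lam : ℝ≥0,
      IsMinOn (MEV.dualObjective μ (MEV.arrival ξ) (MEV.mark x Y) δ) Set.univ lam →
      (⨅ P ∈ MEV.wassersteinBall P₀ δ, MEV.cdfProb P) =
          EReal.exp (-((∫⁻ N, N.1 (MEV.shiftedRegion (lam : ℝ≥0∞)⁻¹) ∂P₀ : ℝ≥0∞) : EReal)) ∧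
      (⨅ P ∈ MEV.wassersteinBall P₀ δ, MEV.voidProb P) =
          EReal.exp (-((∫⁻ N, N.1 (MEV.shiftedRegion (lam : ℝ≥0∞)⁻¹) ∂P₀ : ℝ≥0∞) : EReal)) := by
  subst hP₀
  have hA := MEV.measurable_arrival hξm
  have hmax := MEV.measurable_weightedMax x
  have hVm : ∀ n, Measurable (MEV.mark x Y n) := fun n => hmax.comp (hYm n)
  have hV : iIndepFun (MEV.mark x Y) μ := hY.comp (fun _ y => ⨆ k, x k * y k) fun _ => hmax
  have hVlaw : ∀ n, IdentDistrib (MEV.mark x Y n) (MEV.mark x Y 0) μ μ :=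
    fun n => (hYlaw n).comp hmax
  have hξV : IndepFun (fun ω n => ξ n ω) (fun ω n => MEV.mark x Y n ω) μ :=
    hξY.comp (φ := id) (ψ := fun (y : ℕ → Fin d → ℝ) n => ⨆ k, x k * y n k) measurable_id
      (measurable_pi_lambda _ fun n => hmax.comp (measurable_pi_apply n))
  have hApos := MEV.ae_arrival_pos hξm hξlaw
  have hlt : MeasurableSet {z : ℝ × ℝ | z.1 < z.2} := measurableSet_lt measurable_fst measurable_snd
  have hregion : MeasurableSet MEV.region :=
    (measurableSet_le measurable_const measurable_fst).inter
      (measurableSet_le measurable_fst measurable_snd)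
  refine ⟨?_, MEV.exists_isMinOn_dualObjective hA hVm, fun lam hmin => ?_⟩
  · rw [MEV.cdfProb, Measure.map_apply (MEV.measurable_baseline hA hVm)
      (MEV.measurableSet_config_void hlt)]
    refine measure_congr (Filter.eventuallyEq_set.2 ?_)
    filter_upwards [hApos] with ω hω
    refine Iff.trans ?_ (MEV.maxComponent_le_iff hd hx ξ Y hω).symm
    refine (MEV.baseline_eq_zero_iff (MEV.arrival ξ) (MEV.mark x Y) ω hlt).trans ?_
    simp
  · have hr : (0 : ℝ≥0∞) < (lam : ℝ≥0∞)⁻¹ := by simp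
    -- At level 0 this says that touching the diagonal without crossing it has probability zero.
    have hpos := MEV.measure_forall_le_arrival_le hξm hVm hξ hξlaw hV hVlaw hξV 0
    simp only [NNReal.coe_zero, add_zero, ENNReal.coe_zero] at hpos
    have hge : (lam : ℝ≥0∞)⁻¹ ≠ ⊤ → (δ : ℝ≥0∞) ≤ ∫⁻ ω in
        {ω | MEV.gap (MEV.arrival ξ) (MEV.mark x Y) ω < (lam : ℝ≥0∞)⁻¹},
          MEV.gap (MEV.arrival ξ) (MEV.mark x Y) ω ∂μ := fun hlam => by
      refine MEV.le_setLIntegral_gap hA hVm hmin hlam ?_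
      obtain ⟨r, hr'⟩ : ∃ r : ℝ≥0, (r : ℝ≥0∞) = (lam : ℝ≥0∞)⁻¹ :=
        ⟨_, ENNReal.coe_toNNReal hlam⟩
      rw [← hr'] at hr ⊢
      refine le_trans (measure_mono fun ω hω => ?_)
        (MEV.measure_forall_le_arrival_le hξm hVm hξ hξlaw hV hVlaw hξV r)
      exact (MEV.coe_le_gap_iff (by exact_mod_cast hr)).1 hω
    have hle := MEV.setLIntegral_gap_le hA hVm hmin
    rw [← MEV.measure_le_gap hξm hVm hξ hξlaw hV hVlaw hξV hr]
    constructor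
    · exact MEV.iInf_ball_eq hA hVm hlt (fun z hz => le_of_lt hz)
        (ae_of_all _ fun ω n v hv => hv) hr hpos hle hge
    · refine MEV.iInf_ball_eq hA hVm hregion (fun z hz => hz.2) ?_ hr hpos hle hge
      -- Positive arrival times place every point above the diagonal in the closed region, despite
      -- its constraint 0 ≤ a.
      filter_upwards [hApos] with ω hω n v hv
      exact ⟨(hω n).le, hv.le⟩
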